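/- **Theorem (two-clock priced timed automata with one stopwatch cost).** Fix a finite non-empty set $AP$ of atomic propositions. The following problem is undecidable: given a non-blocking priced timed automaton $\mathcal A$ with two clocks and a single stopwatch cost, whose locations are labeled by subsets of $AP$, and given a WMTL formula $\varphi$ over $AP$, decide whether there is a finite run $\varrho$ of $\mathcal A$ from its initial state with $\varrho\models\varphi$. That is, no algorithm answers this question correctly on all such inputs $(\mathcal A,\varphi)$ (its answers on other inputs being arbitrary). *Automata.* $\mathcal A$ consists of a finite set $Q$ of locations, an initial location $q_0$, a set $X$ of clocks (here $|X|=2$), a finite set $E$ of transitions $(q,g,R,q')$ with $q,q'\in Q$, $R\subseteq X$ and $g$ a clock constraint, an invariant $\mathrm{Inv}(q)$ (a clock constraint) for each $q\in Q$, a labeling $\ell:Q\to 2^{AP}$, and a cost function $\mathrm{cost}:Q\cup E\to\mathbb N$. Clock constraints are generated by $g::=x\sim c\mid g\wedge g$ with $x\in X$, $c\in\mathbb N$, ${\sim}\in\{<,\le,=,\ge,>\}$. The cost is *stopwatch* if $\mathrm{cost}(Q)\subseteq\{0,1\}$. For $v\in\mathbb R_{\ge0}^X$, there is a *mixed move* $(q,v)\xrightarrow{t,e}(q',v')$,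 with $t\in\mathbb R_{\ge0}$ and $e=(q,g,R,q')\in E$, if $v+t'\models\mathrm{Inv}(q)$ for all $0\le t'\le t$, $v+t\models g$, $v'$ is obtained from $v+t$ by setting the clocks of $R$ to $0$, and $v'\models\mathrm{Inv}(q')$; its cost is $t\cdot\mathrm{cost}(q)+\mathrm{cost}(e)$. The initial state is $(q_0,\mathbf 0)$. A finite run is a finite sequence of mixed moves. $\mathcal A$ is *non-blocking* if $\mathbf 0\models\mathrm{Inv}(q_0)$ and a mixed move is possible from every $(q,v)$ with $v\models\mathrm{Inv}(q)$. *WMTL.* Formulas are $\varphi::=a\mid\neg\varphi\mid\varphi\vee\varphi\mid\varphi\,\mathbf U_{\sim c}\,\varphi$ with $a\in AP$, $c\in\mathbb N$ and ${\sim}$ as above. For a finite run $\varrho$ with $n$ moves, starting in $(q,v)$, let $\varrho_{\le\pi}$ and $\varrho_{\ge\pi}$ be its prefix up to, and its suffix from, position $\pi\le n$, and let $\mathrm{cost}(\varrho_{\le\pi})$ be the sum of the costs of the first $\pi$ moves. Then $\varrho\models a$ iff $a\in\ell(q)$, Boolean connectives are as usual, and $\varrho\models\varphi_1\mathbf U_{\sim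 c}\varphi_2$ iff there is $0<\pi\le n$ with $\varrho_{\ge\pi}\models\varphi_2$, $\varrho_{\ge\pi'}\models\varphi_1$ for all $0<\pi'<\pi$, and $\mathrm{cost}(\varrho_{\le\pi})\sim c$. -/

import Mathlib

open scoped NNReal

/-- The comparison symbols `<`, `≤`, `=`, `≥`, `>`. -/
inductive Cmp where
  | lt | le | eq | ge | gt

namespace Cmp

/-- `r.Holds x c` means `x ∼ c`, where `∼` is the comparison symbol `r`. -/
def Holds : Cmp → ℝ≥0 → ℕ → Prop
  | lt, x, c => x < c
  | le, x, c => x ≤ c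
  | eq, x, c => x = c
  | ge, x, c => x ≥ c
  | gt, x, c => x > c

/-- The enumeration of the five comparison symbols. -/
def equivFin : Cmp ≃ Fin 5 where
  toFun r := match r with
    | lt => 0
    | le => 1
    | eq => 2
    | ge => 3
    | gt => 4
  invFun i := match i with
    | 0 => lt
    | 1 => le
    | 2 => eq
    | 3 => ge
    | 4 => gt
  left_inv r := by cases r <;> rfl
  right_inv i := by fin_cases i <;> rfl

instance : Primcodable Cmp := Primcodable.ofEquiv (Fin 5) equivFin

end Cmp

/-- Clock constraints over the set of clocks `X`: `g ::= x ∼ c ∣ g ∧ g` with `c ∈ ℕ`. -/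
inductive ClockConstraint (X : Type) where
  | atom (x : X) (r : Cmp) (c : ℕ)
  | and (g h : ClockConstraint X)

namespace ClockConstraint

/-- `g.Sat v`: the clock valuation `v` satisfies the constraint `g`. -/
def Sat {X : Type} : ClockConstraint X → (X → ℝ≥0) → Prop
  | atom x r c, v => r.Holds (v x) c
  | and g h, v => g.Sat v ∧ h.Sat v

/-- The conjuncts of a clock constraint, from left to right. -/
def conjuncts {X : Type} : ClockConstraint X → List (X × Cmp × ℕ)
  | atom x r c => [(x, r, c)]
  | and g h => g.conjuncts ++ h.conjuncts

end ClockConstraint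

/-- A transition `(q, g, R, q')` between locations in `L`, with guard `g` and set `R` of clocks to
be reset; `R` is given by its characteristic function. -/
structure Edge (L X : Type) where
  source : L
  guard : ClockConstraint X
  reset : X → Bool
  target : L

/-- Labeled priced timed automata with locations `L`, clocks `X`, cost variables `P` and atomic
propositions `A`. The finite set of transitions is given by a list of its elements. The `i`-th cost
function is the pair of `rate i` (on locations) and `edgeCost i` (on transitions; only its values
on the transitions of the automaton matter). -/
structure PPTA (L X P A : Type) where
  init : L
  edges : List (Edge L X)
  inv : L → ClockConstraint X
  rate : P → L → ℕ
  edgeCost : P → Edge L X → ℕ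
  label : L → A → Bool

namespace PPTA

variable {L X P A : Type}

/-- The `i`-th cost is `S`-sloped: all its slopes in locations lie in `S`. -/
def IsSloped (𝒜 : PPTA L X P A) (i : P) (S : Set ℕ) : Prop :=
  ∀ q, 𝒜.rate i q ∈ S

/-- The `i`-th cost is a stopwatch cost. -/
def IsStopwatch (𝒜 : PPTA L X P A) (i : P) : Prop :=
  𝒜.IsSloped i {0, 1}

/-- Delay move `(q, v) —t→ (q, v + t)`. -/
def DelayMove (𝒜 : PPTA L X P A) (s : L × (X → ℝ≥0)) (t : ℝ≥0) (s' : L × (X → ℝ≥0)) : Prop :=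
  s'.1 = s.1 ∧ (∀ x, s'.2 x = s.2 x + t) ∧
    ∀ t' ≤ t, (𝒜.inv s.1).Sat (fun x => s.2 x + t')

/-- Discrete move `(q, v) —e→ (q', v')`. -/
def DiscreteMove (𝒜 : PPTA L X P A) (s : L × (X → ℝ≥0)) (e : Edge L X)
    (s' : L × (X → ℝ≥0)) : Prop :=
  e ∈ 𝒜.edges ∧ s.1 = e.source ∧ s'.1 = e.target ∧ e.guard.Sat s.2 ∧
    (∀ x, s'.2 x = if e.reset x then 0 else s.2 x) ∧ (𝒜.inv s'.1).Sat s'.2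

/-- Mixed move: a delay move followed by a discrete move. -/
def MixedMove (𝒜 : PPTA L X P A) (s : L × (X → ℝ≥0)) (t : ℝ≥0) (e : Edge L X)
    (s' : L × (X → ℝ≥0)) : Prop :=
  ∃ s'', 𝒜.DelayMove s t s'' ∧ 𝒜.DiscreteMove s'' e s'

/-- The initial state: the initial location with all clocks equal to zero. -/
def initialState (𝒜 : PPTA L X P A) : L × (X → ℝ≥0) := (𝒜.init, fun _ => 0)

/-- The initial state satisfies its invariant, and every state that satisfies its invariant admits
a mixed move. -/
def NonBlocking (𝒜 : PPTA L X P A) : Prop :=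
  (𝒜.inv 𝒜.init).Sat 𝒜.initialState.2 ∧
    ∀ s : L × (X → ℝ≥0), (𝒜.inv s.1).Sat s.2 → ∃ t e s', 𝒜.MixedMove s t e s'

/-- Finite runs: sequences of `length` many mixed moves
`state i —(delay i, edge i)→ state (i + 1)`. The values of `state` beyond `length`, and those of
`delay` and `edge` from `length` on, are irrelevant. -/
structure Run (𝒜 : PPTA L X P A) where
  length : ℕ
  state : ℕ → L × (X → ℝ≥0)
  delay : ℕ → ℝ≥0
  edge : ℕ → Edge L X
  move : ∀ i < length, 𝒜.MixedMove (state i) (delay i) (edge i) (state (i + 1))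

end PPTA

/-- Formulas of the logic WMTL over atomic propositions `A` and cost variables `P`;
`until φ i r c ψ` is `φ U_{i ∼ c} ψ` where `∼` is `r`. -/
inductive WMTL (P A : Type) where
  | atom (a : A)
  | not (φ : WMTL P A)
  | or (φ ψ : WMTL P A)
  | until (φ : WMTL P A) (i : P) (r : Cmp) (c : ℕ) (ψ : WMTL P A)

namespace PPTA.Run

variable {L X P A : Type} {𝒜 : PPTA L X P A}

/-- The suffix of a run from position `π` on. -/
def suffix (ρ : 𝒜.Run) (π : ℕ) : 𝒜.Run where
  length := ρ.length - π
  state i := ρ.state (π + i)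
  delay i := ρ.delay (π + i)
  edge i := ρ.edge (π + i)
  move i hi := ρ.move (π + i) (by omega)

/-- The `i`-th cost of the prefix of a run that ends at position `π`. -/
noncomputable def prefixCost (ρ : 𝒜.Run) (i : P) (π : ℕ) : ℝ≥0 :=
  ∑ k ∈ Finset.range π,
    (ρ.delay k * (𝒜.rate i (ρ.state k).1 : ℝ≥0) + (𝒜.edgeCost i (ρ.edge k) : ℝ≥0))

/-- Pointwise semantics of WMTL over finite runs. -/
def Sat : 𝒜.Run → WMTL P A → Prop
  | ρ, .atom a => 𝒜.label (ρ.state 0).1 a = true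
  | ρ, .not φ => ¬ ρ.Sat φ
  | ρ, .or φ ψ => ρ.Sat φ ∨ ρ.Sat ψ
  | ρ, .until φ i r c ψ => ∃ π, 0 < π ∧ π ≤ ρ.length ∧ (ρ.suffix π).Sat ψ ∧
      (∀ π', 0 < π' → π' < π → (ρ.suffix π').Sat φ) ∧ r.Holds (ρ.prefixCost i π) c

end PPTA.Run

/-- The existential model-checking question: some finite run of `𝒜` from the initial state
satisfies `φ`. -/
def PPTA.ModelChecks {L X P A : Type} (𝒜 : PPTA L X P A) (φ : WMTL P A) : Prop :=
  ∃ ρ : 𝒜.Run, ρ.state 0 = 𝒜.initialState ∧ ρ.Sat φ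

/-- Codes of automata with `k` clocks, `p` costs and `a` atomic propositions: the number of the
initial location, the list of all locations (invariant, slopes, label), and the list of all
transitions (source, guard, reset set, target, costs). -/
abbrev PPTACode (k p a : ℕ) : Type :=
  ℕ × List (List (Fin k × Cmp × ℕ) × (Fin p → ℕ) × (Fin a → Bool)) ×
    List (ℕ × List (Fin k × Cmp × ℕ) × (Fin k → Bool) × ℕ × (Fin p → ℕ))

/-- The code of an automaton whose locations are numbered `0, …, n - 1`. -/
def PPTA.code {n k p a : ℕ} (𝒜 : PPTA (Fin n) (Fin k) (Fin p) (Fin a)) : PPTACode k p a :=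
  (𝒜.init.val,
    List.ofFn fun q => ((𝒜.inv q).conjuncts, fun i => 𝒜.rate i q, 𝒜.label q),
    𝒜.edges.map fun e =>
      (e.source.val, e.guard.conjuncts, e.reset, e.target.val, fun i => 𝒜.edgeCost i e))

/-- The alphabet in which WMTL formulas are written down: an atomic proposition, or negation
(`none`), or disjunction (`some none`), or an until modality with its cost constraint. -/
abbrev WMTLToken (p a : ℕ) : Type :=
  Fin a ⊕ Option (Option (Fin p × Cmp × ℕ))

/-- The code of a WMTL formula: the word that writes it in prefix notation. -/
def WMTL.code {p a : ℕ} : WMTL (Fin p) (Fin a) → List (WMTLToken p a)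
  | .atom x => [Sum.inl x]
  | .not φ => Sum.inr none :: φ.code
  | .or φ ψ => Sum.inr (some none) :: (φ.code ++ ψ.code)
  | .until φ i r c ψ => Sum.inr (some (some (i, r, c))) :: (φ.code ++ ψ.code)

/-! The halting problem of one fixed Turing machine is reduced to the question. Each half of the
tape is a number in [0,1], read in base `base Γ`, and is stored as the offset of an event inside a
time block of length U = `unit`. Clock 0 is reset at the end of each block and forces its length.
Clock 1 is reset at the event, and testing it for U at the next event repeats the offset in the next
block. So the clocks carry one number from block to block; the second number is carried by the
formula.

A macro is a row of blocks. In macro j, block 0 repeats the offset u(j+1) inherited from the macro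
before; block 1 has a free offset, meant to be u(j), which `up` further blocks repeat; then a fresh
offset u(j+2) is guessed and repeated up to the end. (Only the start macro has prescribed offsets in
blocks 0 and 1.) The stopwatch runs for U - u(j) in each of `up` blocks and for u(j+2) in each of
`down + 1` blocks, and a constant `fill` is added. The formula demands that, from the first and from
the second location of block 0, some location with false label lies at cost distance exactly `gap`.
The constants are such that only block 1 of macro j+1 can be hit (`Control.Accepted.target`). The
first link then says up·(U - u(j)) + (down+1)·u(j+2) + fill = total, and the difference of the two
links says that block 1 of macro j+1 has offset u(j+1).

Hence macro j applies an affine map to u(j), and the two numbers take turns. Suitable `up`, `down`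
and `fill` make the map a push or a pop of a digit; guessing a wrong digit for a pop would require
an offset outside [0,U] (`TapeOp.Evolves.exists_rel`). One Turing step is two macros, one for each
half tape.

Traces and register paths are related by `Control.Accepted.exists_path` and
`Control.IsPath.accepted`, and paths and computations by `TapeControl.modelChecks_iff`. In
`UniversalMachine.exists_undecidable` the input depends on k only through the number of copies of
one symbol, so the graph is fixed and its constants are primitive recursive in k. -/

/-! ### The automaton of a control graph -/

/-- A control graph: macros, the macro at the start, their successors, the macros that may exit,
and the numbers of blocks by which a macro scales its register down and up. -/
structure Control (T : Type) where
  start : T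
  next : T → T → Prop
  exit : T → Prop
  up : T → ℕ
  down : T → ℕ
  len : ℕ
  up_add_down_le : ∀ t, up t + down t ≤ len
  not_next_start : ∀ t, ¬ next t start

/-- The numerical constants of the automaton of a control graph. -/
structure Scale (T : Type) where
  unit : ℕ
  input : ℕ
  total : ℕ
  fill : T → ℕ

/-- The cost distance that the formula prescribes. -/
def Scale.gap {T : Type} (P : Scale T) : ℕ := P.total + 3 * P.unit + 3

namespace Control

variable {T : Type}

/-- Two locations for each block of each macro, a final location and a sink. -/
abbrev Loc (G : Control T) : Type := (T × Fin (G.len + 3) × Bool) ⊕ Bool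

/-- The first location of a macro. -/
def entry (G : Control T) (t : T) : G.Loc := .inl (t, ⟨0, by omega⟩, false)

/-- The pairs of locations that are joined by a transition. -/
def Allowed (G : Control T) : G.Loc → G.Loc → Prop
  | .inl (t, i, false), .inl (t', i', b) => b = true ∧ t' = t ∧ i' = i
  | .inl (t, i, true), .inl (t', i', b) => b = false ∧
      ((t' = t ∧ i'.val = i.val + 1) ∨ (i.val = G.len + 2 ∧ i'.val = 0 ∧ G.next t t'))
  | .inl (t, i, b), .inr true => b = true ∧ i.val = 1 ∧ G.exit t
  | .inl _, .inr false => True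
  | .inr true, .inr _ => True
  | .inr false, .inr false => True
  | .inr _, _ => False

open Classical in
/-- The guard of the event in the `i`-th block of a macro. -/
noncomputable def eventGuard (G : Control T) (P : Scale T) (t : T) (i : ℕ) :
    ClockConstraint (Fin 2) :=
  if i = 0 then (if t = G.start then .atom 0 .eq 0 else .atom 1 .eq P.unit)
  else if i = 1 then (if t = G.start then .atom 0 .eq P.input else .atom 0 .ge 0)
  else if i = G.up t + 2 then .atom 0 .ge 0 else .atom 1 .eq P.unit

/-- The guards of the transitions. -/
noncomputable def guard (G : Control T) (P : Scale T) : G.Loc → G.Loc → ClockConstraint (Fin 2)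
  | .inl (t, i, false), .inl _ => G.eventGuard P t i
  | .inl (_, _, true), .inl _ => .atom 0 .eq P.unit
  | .inl _, .inr true => .atom 0 .eq P.unit
  | _, _ => .atom 0 .ge 0

/-- The reset sets of the transitions. -/
def reset (G : Control T) : G.Loc → G.Loc → Fin 2 → Bool
  | .inl (_, _, false), .inl _ => fun z => z == 1
  | .inl (_, _, true), .inl _ => fun z => z == 0
  | _, _ => fun _ => false

/-- The slopes of the cost in the locations. -/
def rate (G : Control T) : G.Loc → ℕ
  | .inl (t, i, false) =>
      if i.val ≤ 1 ∨ (G.up t + 2 ≤ i.val ∧ i.val ≤ G.up t + G.down t + 2) then 1 else 0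
  | .inl (t, i, true) => if i.val < G.up t + 2 then 1 else 0
  | .inr true => 1
  | .inr false => 0

/-- The costs of the transitions. -/
def gain (G : Control T) (P : Scale T) : G.Loc → G.Loc → ℕ
  | .inl (_, i, false), .inl _ => if i.val ≤ 1 then 1 else 0
  | .inl (t, i, true), .inl _ => if i.val = G.len + 2 then P.fill t else 0
  | _, _ => 0

/-- The label of a location. -/
def lab (G : Control T) : G.Loc → Bool
  | .inl (_, i, _) => i.val != 1
  | .inr b => !b

end Control

section Automaton

variable {T : Type} [Fintype T] (G : Control T) (P : Scale T)

/-- The number of locations. -/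
noncomputable def Control.card : ℕ := Fintype.card G.Loc

/-- The numbering of the locations. -/
noncomputable def Control.num : G.Loc ≃ Fin G.card := Fintype.equivFin _

/-- The transition between two locations. -/
noncomputable def Control.trans (p : G.Loc × G.Loc) : Edge (Fin G.card) (Fin 2) where
  source := G.num p.1
  guard := G.guard P p.1 p.2
  reset := G.reset p.1 p.2
  target := G.num p.2

open Classical in
/-- The list of the pairs of locations that are joined by a transition. -/
noncomputable def Control.pairs : List (G.Loc × G.Loc) :=
  (Finset.univ.filter fun p : G.Loc × G.Loc => G.Allowed p.1 p.2).toList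

/-- The automaton of a control graph. -/
noncomputable def Control.automaton (a : ℕ) :
    PPTA (Fin G.card) (Fin 2) (Fin 1) (Fin a) where
  init := G.num (G.entry G.start)
  edges := G.pairs.map (G.trans P)
  inv _ := .atom 0 .ge 0
  rate _ q := G.rate (G.num.symm q)
  edgeCost _ e := G.gain P (G.num.symm e.source) (G.num.symm e.target)
  label q _ := G.lab (G.num.symm q)

theorem Control.isStopwatch (a : ℕ) : (G.automaton P a).IsStopwatch 0 := by
  intro q
  change G.rate (G.num.symm q) ∈ _
  rcases G.num.symm q with ⟨t, i, b⟩ | b <;> cases b <;> simp only [Control.rate] <;>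
    (try split_ifs) <;> simp

theorem Control.mem_edges {a : ℕ} {e : Edge (Fin G.card) (Fin 2)} :
    e ∈ (G.automaton P a).edges ↔ ∃ p q, G.Allowed p q ∧ e = G.trans P (p, q) := by
  simp [Control.automaton, Control.pairs, eq_comm]

/-- All invariants are trivially true and a transition is determined by its end points, so a move
amounts to a delay and a next location. -/
theorem Control.mixedMove_iff {a : ℕ} {s s' : Fin G.card × (Fin 2 → ℝ≥0)} {t : ℝ≥0}
    {e : Edge (Fin G.card) (Fin 2)} :
    (G.automaton P a).MixedMove s t e s' ↔
      G.Allowed (G.num.symm s.1) (G.num.symm s'.1) ∧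
      e = G.trans P (G.num.symm s.1, G.num.symm s'.1) ∧
      (G.guard P (G.num.symm s.1) (G.num.symm s'.1)).Sat (fun x => s.2 x + t) ∧
      ∀ x, s'.2 x = if G.reset (G.num.symm s.1) (G.num.symm s'.1) x then 0 else s.2 x + t := by
  constructor
  · rintro ⟨u, ⟨hu1, hu2, -⟩, he, h1, h2, h3, h4, -⟩
    obtain ⟨p, q, hpq, rfl⟩ := (G.mem_edges P).1 he
    have hp : G.num.symm s.1 = p := by
      rw [← hu1, h1]; simp [Control.trans]
    have hq : G.num.symm s'.1 = q := by rw [h2]; simp [Control.trans]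
    rw [hp, hq]
    have hu : u.2 = fun x => s.2 x + t := funext hu2
    rw [hu] at h3
    refine ⟨hpq, rfl, h3, fun x => ?_⟩
    rw [h4, hu]; rfl
  · rintro ⟨h1, rfl, h2, h3⟩
    refine ⟨(s.1, fun x => s.2 x + t), ⟨rfl, fun _ => rfl, fun _ _ => ?_⟩,
      (G.mem_edges P).2 ⟨_, _, h1, rfl⟩, ?_, ?_, h2, h3, ?_⟩
    · simp [Control.automaton, ClockConstraint.Sat, Cmp.Holds]
    · simp [Control.trans]
    · simp [Control.trans]
    · simp [Control.automaton, ClockConstraint.Sat, Cmp.Holds]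

/-- An unguarded transition leads from every location, the sink included, to the sink. -/
theorem Control.nonBlocking (a : ℕ) : (G.automaton P a).NonBlocking := by
  refine ⟨by simp [Control.automaton, ClockConstraint.Sat, Cmp.Holds], fun s _ => ?_⟩
  refine ⟨0, _, (G.num (.inr false), s.2), (G.mixedMove_iff P).2 ⟨?_, rfl, ?_, ?_⟩⟩
  all_goals
    simp only [Equiv.symm_apply_apply]
    rcases G.num.symm s.1 with ⟨t, i, b⟩ | b <;> cases b <;>
      simp [Control.Allowed, Control.guard, Control.reset, ClockConstraint.Sat, Cmp.Holds]

end Automaton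

/-! ### Traces -/

/-- A run of the automaton of a control graph, from the initial state. -/
structure Control.IsTrace {T : Type} (G : Control T) (P : Scale T) (l : ℕ → G.Loc) (d : ℕ → ℝ≥0)
    (c : ℕ → Fin 2 → ℝ≥0) (N : ℕ) : Prop where
  loc_zero : l 0 = G.entry G.start
  clock_zero : ∀ x, c 0 x = 0
  allowed : ∀ n < N, G.Allowed (l n) (l (n + 1))
  sat : ∀ n < N, (G.guard P (l n) (l (n + 1))).Sat (fun x => c n x + d n)
  clock : ∀ n < N, ∀ x, c (n + 1) x = if G.reset (l n) (l (n + 1)) x then 0 else c n x + d n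

/-- The cost accumulated along a trace. -/
noncomputable def Control.cum {T : Type} (G : Control T) (P : Scale T) (l : ℕ → G.Loc)
    (d : ℕ → ℝ≥0) (n : ℕ) : ℝ≥0 :=
  ∑ k ∈ Finset.range n, (d k * (G.rate (l k) : ℝ≥0) + (G.gain P (l k) (l (k + 1)) : ℝ≥0))

theorem Control.cum_succ {T : Type} (G : Control T) (P : Scale T) (l : ℕ → G.Loc)
    (d : ℕ → ℝ≥0) (n : ℕ) : G.cum P l d (n + 1) =
      G.cum P l d n + (d n * (G.rate (l n) : ℝ≥0) + (G.gain P (l n) (l (n + 1)) : ℝ≥0)) :=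
  Finset.sum_range_succ _ _

theorem Control.cum_mono {T : Type} (G : Control T) (P : Scale T) (l : ℕ → G.Loc)
    (d : ℕ → ℝ≥0) : Monotone (G.cum P l d) :=
  monotone_nat_of_le_succ fun n => by rw [G.cum_succ]; exact le_self_add

/-! ### The formula -/

namespace WMTL

variable {A : Type} (x : A) (C : ℕ)

/-- Truth. -/
def top : WMTL (Fin 1) A := .or (.atom x) (.not (.atom x))

/-- `X ψ`. -/
def next (ψ : WMTL (Fin 1) A) : WMTL (Fin 1) A := .until (.not (top x)) 0 .ge 0 ψ

/-- `X X ¬x`. -/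
def later : WMTL (Fin 1) A := next x (next x (.not (.atom x)))

/-- `x ∧ X X ¬x → F_{=C} ¬x`. -/
def link : WMTL (Fin 1) A :=
  .or (.not (.atom x)) (.or (.not (later x)) (.until (top x) 0 .eq C (.not (.atom x))))

/-- `¬x ∧ X X ¬x`. -/
def finish : WMTL (Fin 1) A := .not (.or (.atom x) (.not (later x)))

/-- `link ∧ link U finish`. -/
def halting : WMTL (Fin 1) A :=
  .not (.or (.not (link x C)) (.not (.until (link x C) 0 .ge 0 (finish x))))

end WMTL

/-! ### The meaning of the formula on runs. -/

namespace PPTA.Run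

variable {L X A : Type} {𝒜 : PPTA L X (Fin 1) A} (ρ : 𝒜.Run) (x : A) (C : ℕ)

theorem suffix_suffix (m n : ℕ) : (ρ.suffix m).suffix n = ρ.suffix (m + n) := by
  simp only [suffix, Run.mk.injEq, Nat.add_assoc, and_self, and_true]
  omega

theorem suffix_zero : ρ.suffix 0 = ρ := by
  cases ρ; simp [suffix]

theorem prefixCost_suffix (m n : ℕ) :
    ρ.prefixCost 0 (m + n) = ρ.prefixCost 0 m + (ρ.suffix m).prefixCost 0 n :=
  Finset.sum_range_add _ _ _

theorem sat_top : ρ.Sat (WMTL.top x) := by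
  simp only [WMTL.top, Sat]; tauto

/-- The until is strict, and its unsatisfiable left argument forbids skipping position 1. -/
theorem sat_next (m : ℕ) (ψ : WMTL (Fin 1) A) : (ρ.suffix m).Sat (WMTL.next x ψ) ↔
    m + 1 ≤ ρ.length ∧ (ρ.suffix (m + 1)).Sat ψ := by
  simp only [WMTL.next, Sat, sat_top, suffix_suffix]
  constructor
  · rintro ⟨k, h1, h2, h3, h4, -⟩
    have hk : k = 1 := by
      by_contra h
      exact h4 1 one_pos (by omega) trivial
    subst hk
    simp only [suffix] at h2
    exact ⟨by omega, h3⟩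
  · rintro ⟨h1, h2⟩
    exact ⟨1, one_pos, by simp only [suffix]; omega, h2, by omega, by simp [Cmp.Holds]⟩

theorem sat_later (m : ℕ) : (ρ.suffix m).Sat (WMTL.later x) ↔
    m + 2 ≤ ρ.length ∧ 𝒜.label (ρ.state (m + 2)).1 x = false := by
  rw [WMTL.later, sat_next, sat_next]
  simp only [Sat, suffix, Nat.add_zero, Nat.add_assoc, Nat.reduceAdd, Bool.not_eq_true]
  constructor
  · rintro ⟨-, h⟩; exact h
  · rintro ⟨h, h'⟩; exact ⟨by omega, h, h'⟩

/-- The meaning of `WMTL.link` at position `m`. -/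
def Link (m : ℕ) : Prop :=
  𝒜.label (ρ.state m).1 x = true → m + 2 ≤ ρ.length →
    𝒜.label (ρ.state (m + 2)).1 x = false →
    ∃ q, m < q ∧ q ≤ ρ.length ∧ 𝒜.label (ρ.state q).1 x = false ∧
      ρ.prefixCost 0 q = ρ.prefixCost 0 m + C

theorem sat_link (m : ℕ) : (ρ.suffix m).Sat (WMTL.link x C) ↔ ρ.Link x C m := by
  simp only [WMTL.link, Sat, sat_later, Link, sat_top, suffix_suffix]
  have key : (∃ π, 0 < π ∧ π ≤ (ρ.suffix m).length ∧
      ¬ 𝒜.label ((ρ.suffix (m + π)).state 0).1 x = true ∧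
      (∀ π', 0 < π' → π' < π → True) ∧ Cmp.eq.Holds ((ρ.suffix m).prefixCost 0 π) C) ↔
      ∃ q, m < q ∧ q ≤ ρ.length ∧ 𝒜.label (ρ.state q).1 x = false ∧
      ρ.prefixCost 0 q = ρ.prefixCost 0 m + C := by
    constructor
    · rintro ⟨π, h1, h2, h3, -, h4⟩
      simp only [suffix, Nat.add_zero] at h2 h3
      refine ⟨m + π, by omega, by omega, by simpa using h3, ?_⟩
      rw [prefixCost_suffix, show (ρ.suffix m).prefixCost 0 π = C from h4]
    · rintro ⟨q, h1, h2, h3, h4⟩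
      obtain ⟨π, rfl⟩ := Nat.exists_eq_add_of_lt h1
      rw [Nat.add_assoc, prefixCost_suffix] at h4
      refine ⟨π + 1, by omega, by simp only [suffix]; omega, ?_, by simp, add_left_cancel h4⟩
      simp only [suffix, Nat.add_zero]
      simpa [Nat.add_assoc] using h3
  rw [key]
  simp only [suffix, Nat.add_zero]
  tauto

theorem sat_finish (m : ℕ) : (ρ.suffix m).Sat (WMTL.finish x) ↔
    𝒜.label (ρ.state m).1 x = false ∧ m + 2 ≤ ρ.length ∧
      𝒜.label (ρ.state (m + 2)).1 x = false := by
  simp only [WMTL.finish, Sat, sat_later, not_or, not_not, Bool.not_eq_true]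
  simp [suffix]

theorem sat_halting : ρ.Sat (WMTL.halting x C) ↔ ρ.Link x C 0 ∧
    ∃ m, 0 < m ∧ 𝒜.label (ρ.state m).1 x = false ∧ m + 2 ≤ ρ.length ∧
      𝒜.label (ρ.state (m + 2)).1 x = false ∧ ∀ m', 0 < m' → m' < m → ρ.Link x C m' := by
  simp only [WMTL.halting, Sat, not_or, not_not, sat_link, sat_finish]
  rw [← sat_link, suffix_zero]
  constructor
  · rintro ⟨h1, m, h2, h3, h4, h5, -⟩
    exact ⟨h1, m, h2, h4.1, h4.2.1, h4.2.2, h5⟩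
  · rintro ⟨h1, m, h2, h3, h4, h5, h6⟩
    exact ⟨h1, m, h2, by omega, ⟨h3, h4, h5⟩, h6, by simp [Cmp.Holds]⟩

end PPTA.Run

/-- A trace that the formula `WMTL.halting` accepts: `m` is the position where it stops. -/
structure Control.Accepted {T : Type} (G : Control T) (P : Scale T) (l : ℕ → G.Loc) (d : ℕ → ℝ≥0)
    (c : ℕ → Fin 2 → ℝ≥0) (N m : ℕ) : Prop extends G.IsTrace P l d c N where
  finish : G.lab (l m) = false
  finish_le : m + 2 ≤ N
  finish_later : G.lab (l (m + 2)) = false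
  link : ∀ n < m, G.lab (l n) = true → G.lab (l (n + 2)) = false →
    ∃ q, n < q ∧ q ≤ N ∧ G.lab (l q) = false ∧ G.cum P l d q = G.cum P l d n + P.gap

/-- The strict until does not inspect position 0, which is why `WMTL.halting` has a separate
conjunct for it. The bound `n + 2 ≤ length` in a link is automatic before `m`, since `m + 2 ≤ N`. -/
theorem Control.modelChecks_iff {T : Type} [Fintype T] (G : Control T) (P : Scale T) {a : ℕ}
    (x : Fin a) : (G.automaton P a).ModelChecks (WMTL.halting x P.gap) ↔
      ∃ l d c N m, G.Accepted P l d c N m := by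
  constructor
  · rintro ⟨ρ, h0, hρ⟩
    obtain ⟨hl0, m, hm, h1, h2, h3, h4⟩ := (ρ.sat_halting x _).1 hρ
    set l : ℕ → G.Loc := fun n => G.num.symm (ρ.state n).1 with hl
    have hmove := fun n hn => (G.mixedMove_iff P).1 (ρ.move n hn)
    have hcum : ∀ q ≤ ρ.length, ρ.prefixCost 0 q = G.cum P l ρ.delay q := by
      intro q hq
      refine Finset.sum_congr rfl fun k hk => ?_
      rw [(hmove k (by rw [Finset.mem_range] at hk; omega)).2.1]
      simp [Control.automaton, Control.trans, hl]
    refine ⟨l, ρ.delay, fun n => (ρ.state n).2, ρ.length, m, ⟨⟨?_, ?_, ?_, ?_, ?_⟩, h1, h2, h3, ?_⟩⟩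
    · simp [hl, h0, PPTA.initialState, Control.automaton]
    · simp [h0, PPTA.initialState]
    · exact fun n hn => (hmove n hn).1
    · exact fun n hn => (hmove n hn).2.2.1
    · exact fun n hn => (hmove n hn).2.2.2
    · intro n hn e1 e2
      have : ρ.Link x P.gap n := by
        rcases Nat.eq_zero_or_pos n with rfl | h
        · exact hl0
        · exact h4 n h hn
      obtain ⟨q, k1, k2, k3, k4⟩ := this e1 (by omega) e2
      exact ⟨q, k1, k2, k3, by rw [← hcum q k2, ← hcum n (by omega), k4]⟩
  · rintro ⟨l, d, c, N, m, H⟩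
    let ρ : (G.automaton P a).Run :=
      { length := N
        state := fun n => (G.num (l n), c n)
        delay := d
        edge := fun n => G.trans P (l n, l (n + 1))
        move := fun n hn => (G.mixedMove_iff P).2 (by
          simp only [Equiv.symm_apply_apply]
          exact ⟨H.allowed n hn, trivial, H.sat n hn, H.clock n hn⟩) }
    have hcum : ∀ q, ρ.prefixCost 0 q = G.cum P l d q := by
      intro q
      refine Finset.sum_congr rfl fun k hk => ?_
      simp [ρ, Control.automaton, Control.trans]
    have hlab : ∀ q, (G.automaton P a).label (ρ.state q).1 x = G.lab (l q) := by
      intro q; simp [ρ, Control.automaton]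
    have hlink : ∀ n < m, ρ.Link x P.gap n := by
      intro n hn
      simp only [PPTA.Run.Link, hcum, hlab]
      exact fun h1 _ h2 => H.link n hn h1 h2
    have hm : 0 < m := by
      rcases Nat.eq_zero_or_pos m with rfl | h
      · have := H.finish
        rw [H.loc_zero] at this
        simp [Control.entry, Control.lab] at this
      · exact h
    refine ⟨ρ, ?_, (ρ.sat_halting x _).2 ⟨hlink 0 hm, m, hm, ?_, H.finish_le, ?_,
      fun n _ hn => hlink n hn⟩⟩
    · simp only [ρ, PPTA.initialState, H.loc_zero, Control.automaton]
      rw [funext H.clock_zero]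
    · rw [hlab]; exact H.finish
    · rw [hlab]; exact H.finish_later

/-! ### Blocks of a trace -/

namespace Control

/-- The position where a trace enters the `r`-th block of its `j`-th macro. -/
def pos {T : Type} (G : Control T) (j r : ℕ) : ℕ := 2 * (j * (G.len + 3) + r)

/-- The `j`-th macro of a trace. -/
def mac {T : Type} (G : Control T) (l : ℕ → G.Loc) (j : ℕ) : T :=
  match l (G.pos j 0) with
  | .inl (t, _, _) => t
  | .inr _ => G.start

variable {T : Type} {G : Control T} {P : Scale T}

theorem pos_zero : G.pos 0 0 = 0 := by simp [pos]

theorem pos_succ (j r : ℕ) : G.pos j (r + 1) = G.pos j r + 2 := by simp [pos]; ring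

theorem pos_succ_zero (j : ℕ) : G.pos (j + 1) 0 = G.pos j (G.len + 2) + 2 := by simp [pos]; ring

theorem pos_add (j r : ℕ) : G.pos j r = G.pos j 0 + 2 * r := by simp [pos]; ring

theorem pos_add_two (j : ℕ) : G.pos (j + 1) 0 = G.pos j 0 + 2 * (G.len + 3) := by
  simp [pos]; ring

theorem pos_strictMono {j k : ℕ} (h : j < k) : G.pos (j + 1) 0 ≤ G.pos k 0 := by
  simp only [pos, Nat.add_zero]
  exact Nat.mul_le_mul_left _ (Nat.mul_le_mul_right _ h)

theorem exists_pos (n : ℕ) : ∃ j r, r < G.len + 3 ∧ (n = G.pos j r ∨ n = G.pos j r + 1) := by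
  refine ⟨n / 2 / (G.len + 3), n / 2 % (G.len + 3), Nat.mod_lt _ (by omega), ?_⟩
  simp only [pos]
  rw [Nat.mul_comm (n / 2 / (G.len + 3)), Nat.div_add_mod]
  omega

namespace IsTrace

variable {l : ℕ → G.Loc} {d : ℕ → ℝ≥0} {c : ℕ → Fin 2 → ℝ≥0} {N F : ℕ}

theorem sink_of_le (H : G.IsTrace P l d c N) {m n : ℕ} (hm : l m = .inr false) (hmn : m ≤ n)
    (hn : n ≤ N) : l n = .inr false := by
  induction n, hmn using Nat.le_induction with
  | base => exact hm
  | succ n hmn ih =>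
    have := H.allowed n (by omega)
    rw [ih (by omega)] at this
    rcases h : l (n + 1) with ⟨t, i, b⟩ | b <;> rw [h] at this
    · exact this.elim
    · cases b
      · rfl
      · exact this.elim

theorem post_of_pre (H : G.IsTrace P l d c N) {n : ℕ} (hn : n < N) {t : T}
    {i : Fin (G.len + 3)} (h : l n = .inl (t, i, false)) (h' : (l (n + 1)).isLeft) :
    l (n + 1) = .inl (t, i, true) := by
  have := H.allowed n hn
  rw [h] at this
  rcases e : l (n + 1) with ⟨t', i', b'⟩ | b <;> rw [e] at this h'
  · obtain ⟨rfl, rfl, rfl⟩ := this; rfl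
  · simp at h'

theorem pre_of_post (H : G.IsTrace P l d c N) {n : ℕ} (hn : n < N) {t : T}
    {i : Fin (G.len + 3)} (h : l n = .inl (t, i, true)) (h' : (l (n + 1)).isLeft) :
    ∃ t' i', l (n + 1) = .inl (t', i', false) ∧
      ((t' = t ∧ i'.val = i.val + 1) ∨ (i.val = G.len + 2 ∧ i'.val = 0 ∧ G.next t t')) := by
  have := H.allowed n hn
  rw [h] at this
  rcases e : l (n + 1) with ⟨t', i', b'⟩ | b <;> rw [e] at this h'
  · obtain ⟨rfl, h2⟩ := this
    exact ⟨t', i', rfl, h2⟩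
  · simp at h'

/-! ### Offsets and costs while a trace stays inside the blocks (before position `F`). -/

section Blocks

variable (H : G.IsTrace P l d c N) (hFN : F ≤ N) (hF : ∀ n < F, (l n).isLeft)
include H hFN hF

theorem pre_post (i : ℕ) (h : 2 * i < F) :
    (∃ t r, l (2 * i) = .inl (t, r, false)) ∧
      (2 * i + 1 < F → ∃ t r, l (2 * i + 1) = .inl (t, r, true)) := by
  have key : ∀ i, (∃ t r, l (2 * i) = .inl (t, r, false)) → 2 * i + 1 < F →
      ∃ t r, l (2 * i + 1) = .inl (t, r, true) := by
    rintro i ⟨t, r, e⟩ h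
    exact ⟨t, r, H.post_of_pre (by omega) e (hF _ h)⟩
  have : ∃ t r, l (2 * i) = .inl (t, r, false) := by
    induction i with
    | zero => exact ⟨_, _, H.loc_zero⟩
    | succ i ih =>
      obtain ⟨t, r, e⟩ := key i (ih (by omega)) (by omega)
      obtain ⟨t', r', e', -⟩ := H.pre_of_post (by omega) e (hF (2 * i + 1 + 1) (by omega))
      exact ⟨t', r', e'⟩
  exact ⟨this, key i this⟩

theorem clock_x_pre (i : ℕ) (h : 2 * i < F) : c (2 * i) 0 = 0 := by
  cases i with
  | zero => exact H.clock_zero 0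
  | succ i =>
    obtain ⟨t, r, e⟩ := (H.pre_post hFN hF i (by omega)).2 (by omega)
    obtain ⟨t', r', e'⟩ := (H.pre_post hFN hF (i + 1) (by omega)).1
    have := H.clock (2 * i + 1) (by omega) 0
    rw [e, show 2 * i + 1 + 1 = 2 * (i + 1) by ring, e'] at this
    simpa [Control.reset] using this

theorem clock_post (i : ℕ) (h : 2 * i + 1 < F) :
    c (2 * i + 1) 0 = d (2 * i) ∧ c (2 * i + 1) 1 = 0 := by
  obtain ⟨t, r, e⟩ := (H.pre_post hFN hF i (by omega)).1
  have e' := H.post_of_pre (n := 2 * i) (by omega) e (hF _ h)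
  have h0 := H.clock (2 * i) (by omega) 0
  have h1 := H.clock (2 * i) (by omega) 1
  rw [e, e'] at h0 h1
  rw [H.clock_x_pre hFN hF i (by omega)] at h0
  simp [Control.reset] at h0 h1
  exact ⟨h0, h1⟩

theorem delay_add (i : ℕ) (h : 2 * i + 2 < F) :
    d (2 * i) + d (2 * i + 1) = P.unit ∧ c (2 * i + 2) 1 = d (2 * i + 1) := by
  obtain ⟨t, r, e⟩ := (H.pre_post hFN hF i (by omega)).2 (by omega)
  obtain ⟨t', r', e'⟩ := (H.pre_post hFN hF (i + 1) (by omega)).1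
  obtain ⟨h0, h1⟩ := H.clock_post hFN hF i (by omega)
  have h2 := H.sat (2 * i + 1) (by omega)
  have h3 := H.clock (2 * i + 1) (by omega) 1
  rw [e, show 2 * i + 1 + 1 = 2 * (i + 1) by ring, e'] at h2 h3
  simp [Control.reset, Control.guard, ClockConstraint.Sat, Cmp.Holds, h0, h1] at h2 h3
  exact ⟨h2, h3⟩

/-- Clock 1 was reset at the previous event, so the test places two successive events one block
length apart, that is, at equal offsets. -/
theorem delay_eq_of_keep (i : ℕ) (h : 2 * i + 3 < F)
    (hg : ∀ t r, l (2 * (i + 1)) = .inl (t, r, false) →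
      G.eventGuard P t r = .atom 1 .eq P.unit) :
    d (2 * (i + 1)) = d (2 * i) := by
  obtain ⟨t, r, e⟩ := (H.pre_post hFN hF (i + 1) (by omega)).1
  have e' := H.post_of_pre (n := 2 * (i + 1)) (by omega) e (hF _ (by omega))
  have h2 := H.sat (2 * (i + 1)) (by omega)
  obtain ⟨h3, h4⟩ := H.delay_add hFN hF i (by omega)
  rw [e, e'] at h2
  simp only [Control.guard, hg t r e, ClockConstraint.Sat, Cmp.Holds] at h2
  rw [show 2 * (i + 1) = 2 * i + 2 by ring] at h2 ⊢
  rw [h4, ← h3, add_comm (d (2 * i))] at h2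
  exact add_left_cancel h2

theorem loc_post_of_pre {j r : ℕ} {t : T} {i : Fin (G.len + 3)} (h : G.pos j r + 1 < F)
    (e : l (G.pos j r) = .inl (t, i, false)) : l (G.pos j r + 1) = .inl (t, i, true) :=
  H.post_of_pre (by omega) e (hF _ h)

theorem loc_pre (j r : ℕ) (hr : r < G.len + 3) (h : G.pos j r < F) :
    l (G.pos j r) = .inl (G.mac l j, ⟨r, hr⟩, false) := by
  have inner : ∀ j, (G.pos j 0 < F → l (G.pos j 0) = G.entry (G.mac l j)) →
      ∀ r (hr : r < G.len + 3), G.pos j r < F →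
        l (G.pos j r) = .inl (G.mac l j, ⟨r, hr⟩, false) := by
    intro j h0 r
    induction r with
    | zero => exact fun _ h => h0 h
    | succ r ih =>
      intro hr h
      rw [pos_succ] at h
      have e := H.loc_post_of_pre hFN hF (by omega) (ih (by omega) (by omega))
      obtain ⟨t', i', e', h' | h'⟩ :=
        H.pre_of_post (by omega) e (hF (G.pos j r + 1 + 1) (by omega))
      · rw [pos_succ, e', h'.1]
        congr 3
        exact Fin.ext h'.2
      · have := h'.1
        simp only at this
        omega
  refine inner j ?_ r hr h
  clear h hr r
  induction j with
  | zero =>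
    intro _
    rw [mac, pos_zero, H.loc_zero]
    rfl
  | succ j ih =>
    intro h
    rw [pos_succ_zero] at h
    have e := H.loc_post_of_pre hFN hF (by omega)
      (inner j ih (G.len + 2) (by omega) (by omega))
    obtain ⟨t', i', e', h' | h'⟩ :=
      H.pre_of_post (by omega) e (hF (G.pos j (G.len + 2) + 1 + 1) (by omega))
    · have := i'.2
      have h2 := h'.2
      simp only at h2
      omega
    · have e2 : l (G.pos (j + 1) 0) = .inl (t', i', false) := by rw [pos_succ_zero]; exact e'
      rw [mac, e2]
      simp only [entry]
      congr 3
      exact Fin.ext h'.2.1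

theorem loc_post (j r : ℕ) (hr : r < G.len + 3) (h : G.pos j r + 1 < F) :
    l (G.pos j r + 1) = .inl (G.mac l j, ⟨r, hr⟩, true) :=
  H.loc_post_of_pre hFN hF h (H.loc_pre hFN hF j r hr (by omega))

omit hFN hF in
theorem mac_zero : G.mac l 0 = G.start := by
  rw [mac, pos_zero, H.loc_zero]; rfl

theorem next_mac (j : ℕ) (h : G.pos (j + 1) 0 < F) : G.next (G.mac l j) (G.mac l (j + 1)) := by
  have e' := H.loc_pre hFN hF (j + 1) 0 (by omega) h
  rw [pos_succ_zero] at h e'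
  have e := H.loc_post hFN hF j (G.len + 2) (by omega) (by omega)
  have := H.allowed (G.pos j (G.len + 2) + 1) (by omega)
  rw [e, e'] at this
  rcases this.2 with h' | h'
  · simp at h'
  · exact h'.2.2

theorem mac_succ_ne_start (j : ℕ) (h : G.pos (j + 1) 0 < F) : G.mac l (j + 1) ≠ G.start :=
  fun e => G.not_next_start _ (e ▸ H.next_mac hFN hF j h)

theorem delay_add' (j r : ℕ) (h : G.pos j r + 2 < F) :
    d (G.pos j r) + d (G.pos j r + 1) = P.unit :=
  (H.delay_add hFN hF (j * (G.len + 3) + r) h).1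

/-- No macro has the start macro as successor, so the special guards act here only, to fix the
initial registers. -/
theorem event_zero (h : G.pos 0 1 + 1 < F) : d (G.pos 0 0) = 0 ∧ d (G.pos 0 1) = P.input := by
  have key : ∀ r (hr : r < G.len + 3), G.pos 0 r + 1 < F →
      (G.eventGuard P G.start r).Sat fun x => c (G.pos 0 r) x + d (G.pos 0 r) := by
    intro r hr h
    have h2 := H.sat (G.pos 0 r) (by omega)
    rwa [H.loc_pre hFN hF 0 r hr (by omega), H.loc_post hFN hF 0 r hr h,
      H.mac_zero] at h2
  have hx : ∀ r, G.pos 0 r < F → c (G.pos 0 r) 0 = 0 := fun r h => H.clock_x_pre hFN hF _ h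
  rw [pos_succ] at h
  have h0 := key 0 (by omega) (by omega)
  have h1 := key 1 (by omega) (by rw [pos_succ]; omega)
  simp [eventGuard, ClockConstraint.Sat, Cmp.Holds, hx 0 (by omega),
    hx 1 (by rw [pos_succ]; omega)] at h0 h1
  exact ⟨h0, h1⟩

theorem event_keep (j : ℕ) (h : G.pos (j + 1) 0 + 1 < F) :
    d (G.pos (j + 1) 0) = d (G.pos j (G.len + 2)) := by
  have hs := H.mac_succ_ne_start hFN hF j (by omega)
  have e := H.loc_pre hFN hF (j + 1) 0 (by omega) (by omega)
  have hp : G.pos (j + 1) 0 = 2 * (j * (G.len + 3) + (G.len + 2) + 1) := by simp [pos]; ring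
  rw [hp] at h e ⊢
  refine H.delay_eq_of_keep hFN hF _ (by omega) fun t r e' => ?_
  rw [e] at e'
  cases e'
  simp [eventGuard, hs]

theorem event_gadget (j g : ℕ) (hg : g ≤ G.len) (hu : g ≠ G.up (G.mac l j))
    (h : G.pos j (g + 2) + 1 < F) : d (G.pos j (g + 2)) = d (G.pos j (g + 1)) := by
  have e := H.loc_pre hFN hF j (g + 2) (by omega) (by omega)
  have hp : G.pos j (g + 2) = 2 * (j * (G.len + 3) + (g + 1) + 1) := by simp [pos]; ring
  rw [hp] at h e ⊢
  refine H.delay_eq_of_keep hFN hF _ (by omega) fun t r e' => ?_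
  rw [e] at e'
  cases e'
  simp [eventGuard, hu]

/-- The blocks after block 1 and before the guess all test clock 1, so they repeat the offset of
block 1. -/
theorem event_before (j g : ℕ) (hg : g ≤ G.up (G.mac l j)) (h : G.pos j (g + 1) + 1 < F) :
    d (G.pos j (g + 1)) = d (G.pos j 1) := by
  have hle := G.up_add_down_le (G.mac l j)
  induction g with
  | zero => rfl
  | succ g ih =>
    rw [H.event_gadget hFN hF j g (by omega) (by omega) h, ih (by omega)]
    rw [pos_succ] at h; omega

theorem event_after (j g : ℕ) (hg : G.up (G.mac l j) ≤ g) (hg' : g ≤ G.len)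
    (h : G.pos j (g + 2) + 1 < F) :
    d (G.pos j (g + 2)) = d (G.pos j (G.up (G.mac l j) + 2)) := by
  induction g, hg using Nat.le_induction with
  | base => rfl
  | succ g hg ih =>
    rw [H.event_gadget hFN hF j (g + 1) hg' (by omega) h, ih (by omega)]
    rw [pos_succ] at h; omega

/-- The next macro finds the value that the gadget of the present one has guessed. -/
theorem event_next (j : ℕ) (h : G.pos (j + 1) 0 + 1 < F) :
    d (G.pos j (G.up (G.mac l j) + 2)) = d (G.pos (j + 1) 0) := by
  have hle := G.up_add_down_le (G.mac l j)
  rw [H.event_keep hFN hF j h,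
    H.event_after hFN hF j G.len (by omega) le_rfl (by rw [pos_succ_zero] at h; omega)]

theorem cum_event_pre (j r : ℕ) (hr : r ≤ 1) (h : G.pos j r + 1 < F) :
    G.cum P l d (G.pos j r + 1) = G.cum P l d (G.pos j r) + d (G.pos j r) + 1 := by
  rw [cum_succ, H.loc_pre hFN hF j r (by omega) (by omega),
    H.loc_post hFN hF j r (by omega) h]
  simp [rate, gain, hr, add_assoc]

theorem cum_block_pre (j r : ℕ) (hr : r ≤ 1) (h : G.pos j r + 2 < F) :
    G.cum P l d (G.pos j r + 2) = G.cum P l d (G.pos j r) + P.unit + 1 := by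
  have e := H.loc_pre hFN hF j (r + 1) (by omega) (by rw [pos_succ]; omega)
  rw [pos_succ] at e
  rw [cum_succ, H.cum_event_pre hFN hF j r hr (by omega), e,
    H.loc_post hFN hF j r (by omega) (by omega), ← H.delay_add' hFN hF j r h]
  simp [rate, gain, show r < G.up (G.mac l j) + 2 by omega, show r ≠ G.len + 2 by omega]
  ring

/-- Before the guess the cost runs after the event, which gives the complement of the old offset in
each block. In the `down + 1` blocks from the guess on it runs before the event, which gives the new
offset. Afterwards it stands still. The minima count the blocks of both kinds among the first `g`;
the fill is paid on leaving the last block. -/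
theorem cum_gadget (j g : ℕ) (hg : g ≤ G.len + 1) (h : G.pos j (g + 2) + 1 < F) :
    G.cum P l d (G.pos j (g + 2)) = G.cum P l d (G.pos j 2) +
      ((min g (G.up (G.mac l j)) : ℕ) * d (G.pos j 1 + 1) +
        (min g (G.up (G.mac l j) + G.down (G.mac l j) + 1) - G.up (G.mac l j) : ℕ) *
          d (G.pos j (G.up (G.mac l j) + 2)) +
        (if g = G.len + 1 then P.fill (G.mac l j) else 0 : ℕ)) := by
  have hle := G.up_add_down_le (G.mac l j)
  induction g with
  | zero => simp
  | succ g ih =>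
    have h' := h
    rw [show g + 1 + 2 = g + 2 + 1 by ring, pos_succ] at h
    have hend : ∃ t i b, l (G.pos j (g + 2) + 2) = .inl (t, i, b) := by
      obtain ⟨⟨t, i, b⟩, e⟩ := Sum.isLeft_iff.1 (hF (G.pos j (g + 2) + 2) (by omega))
      exact ⟨t, i, b, e⟩
    obtain ⟨t, i, b, hend⟩ := hend
    rw [show g + 1 + 2 = g + 2 + 1 by ring, pos_succ, cum_succ, cum_succ, hend,
      H.loc_pre hFN hF j (g + 2) (by omega) (by omega),
      H.loc_post hFN hF j (g + 2) (by omega) (by omega), ih (by omega) (by omega)]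
    simp only [rate, gain, show ¬ g + 2 ≤ 1 by omega, false_or, if_false,
      show g ≠ G.len + 1 by omega,
      show (g + 2 = G.len + 2) = (g + 1 = G.len + 1) from propext (by omega)]
    have hpos := pos_add (G := G) j (g + 2)
    have hpos' := pos_add (G := G) j (g + 1 + 1)
    have hpos1 := pos_add (G := G) j 1
    -- The cases: before the guess, from the guess through the `down` blocks after it, and the idle
    -- rest.
    rcases Nat.lt_or_ge g (G.up (G.mac l j)) with h1 | h1
    · have e1 := H.event_before hFN hF j (g + 1) (by omega) (by omega)
      have e2 := H.delay_add' hFN hF j (g + 2) (by omega)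
      have e3 := H.delay_add' hFN hF j 1 (by omega)
      have e4 : d (G.pos j (g + 2) + 1) = d (G.pos j 1 + 1) := by
        rw [show g + 2 = g + 1 + 1 by ring, e1, ← e3] at e2
        exact add_left_cancel e2
      rw [e4, show min (g + 1) (G.up (G.mac l j)) = min g (G.up (G.mac l j)) + 1 by omega,
        show min (g + 1) (G.up (G.mac l j) + G.down (G.mac l j) + 1) - G.up (G.mac l j) = 0 by
          omega,
        show min g (G.up (G.mac l j) + G.down (G.mac l j) + 1) - G.up (G.mac l j) = 0 by omega]
      simp only [show ¬ (G.up (G.mac l j) + 2 ≤ g + 2 ∧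
        g + 2 ≤ G.up (G.mac l j) + G.down (G.mac l j) + 2) by omega,
        show g + 2 < G.up (G.mac l j) + 2 by omega, if_true, if_false]
      split_ifs <;> push_cast <;> ring
    · have e1 := H.event_after hFN hF j g (by omega) (by omega) (by omega)
      rw [e1, show min (g + 1) (G.up (G.mac l j)) = min g (G.up (G.mac l j)) by omega]
      by_cases h2 : g ≤ G.up (G.mac l j) + G.down (G.mac l j)
      · rw [show min (g + 1) (G.up (G.mac l j) + G.down (G.mac l j) + 1) - G.up (G.mac l j) =
          min g (G.up (G.mac l j) + G.down (G.mac l j) + 1) - G.up (G.mac l j) + 1 by omega]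
        simp only [show (G.up (G.mac l j) + 2 ≤ g + 2 ∧
          g + 2 ≤ G.up (G.mac l j) + G.down (G.mac l j) + 2) by omega,
          show ¬ g + 2 < G.up (G.mac l j) + 2 by omega, if_true, if_false, and_self]
        split_ifs <;> push_cast <;> ring
      · rw [show min (g + 1) (G.up (G.mac l j) + G.down (G.mac l j) + 1) - G.up (G.mac l j) =
          min g (G.up (G.mac l j) + G.down (G.mac l j) + 1) - G.up (G.mac l j) by omega]
        simp only [show ¬ (G.up (G.mac l j) + 2 ≤ g + 2 ∧
          g + 2 ≤ G.up (G.mac l j) + G.down (G.mac l j) + 2) by omega,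
          show ¬ g + 2 < G.up (G.mac l j) + 2 by omega, if_false]
        split_ifs <;> push_cast <;> ring

/-- Costs can only be added, so the old offset enters through its complement: a larger old offset
lowers the cost, and the new offset has to make up for it. -/
theorem cum_mac (j : ℕ) (h : G.pos (j + 1) 0 + 1 < F) :
    G.cum P l d (G.pos (j + 1) 0) = G.cum P l d (G.pos j 0) + 2 * (P.unit + 1) +
      (G.up (G.mac l j) * d (G.pos j 1 + 1) +
        (G.down (G.mac l j) + 1) * d (G.pos (j + 1) 0) + P.fill (G.mac l j)) := by
  have hle := G.up_add_down_le (G.mac l j)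
  have hp : G.pos (j + 1) 0 = G.pos j (G.len + 1 + 2) := by rw [pos_succ, pos_succ_zero]
  rw [← H.event_next hFN hF j h, hp]
  rw [hp] at h
  have h2 := pos_add (G := G) j (G.len + 1 + 2)
  have h3 := pos_add (G := G) j 1
  rw [H.cum_gadget hFN hF j (G.len + 1) le_rfl h, pos_succ, H.cum_block_pre hFN hF j 1 le_rfl
    (by omega), show G.pos j 1 = G.pos j 0 + 2 from pos_succ j 0,
    H.cum_block_pre hFN hF j 0 (by omega) (by omega),
    min_eq_right (by omega), min_eq_right (by omega), if_pos rfl,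
    show G.up (G.mac l j) + G.down (G.mac l j) + 1 - G.up (G.mac l j)
      = G.down (G.mac l j) + 1 by omega]
  push_cast
  ring

end Blocks

end IsTrace

end Control

/-! ### Paths of macros -/

/-- A path of macros, with registers: the `j`-th macro consumes `u j` and produces `u (j + 2)`.
The last macros, from the `K`-th on, need not treat the registers correctly. -/
structure Control.IsPath {T : Type} (G : Control T) (P : Scale T) (t : ℕ → T) (u : ℕ → ℝ≥0)
    (J K : ℕ) : Prop where
  start : t 0 = G.start
  next : ∀ j < J, G.next (t j) (t (j + 1))
  exit : G.exit (t J)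
  zero : u 0 = P.input
  one : u 1 = 0
  le_unit : ∀ j ≤ J + 1, u j ≤ P.unit
  eq : ∀ j < K, G.up (t j) * (P.unit : ℝ≥0) + (G.down (t j) + 1) * u (j + 2) + P.fill (t j) =
    P.total + G.up (t j) * u j

/-! ### Reading a register path off an accepted trace. -/

namespace Control.Accepted

variable {T : Type} {G : Control T} {P : Scale T} {l : ℕ → G.Loc} {d : ℕ → ℝ≥0}
  {c : ℕ → Fin 2 → ℝ≥0} {N m : ℕ}

/-- The sink is absorbing and labeled true, so it is not visited up to `m + 2`. If the trace were
still inside the blocks at `m + 2`, it would have gone from block 1 at `m` to block 2, whose label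
is true. So it has entered the final location, and that is possible only from the end of block 1. -/
theorem exists_final (H : G.Accepted P l d c N m) :
    ∃ J, (∀ n < G.pos J 2, (l n).isLeft) ∧ G.pos J 2 ≤ m + 2 ∧ G.exit (G.mac l J) := by
  classical
  have hsink : ∀ n ≤ m + 2, l n ≠ .inr false := by
    intro n hn h
    have := H.finish_later
    rw [H.sink_of_le h hn H.finish_le] at this
    simp [lab] at this
  have hex : ∃ n, n ≤ m + 2 ∧ l n = .inr true := by
    by_contra hno
    push Not at hno
    have hF : ∀ n < m + 3, (l n).isLeft := by
      intro n hn
      rcases h : l n with x | b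
      · rfl
      · cases b
        · exact absurd h (hsink n (by omega))
        · exact absurd h (hno n (by omega))
    obtain ⟨⟨t, i, b⟩, e⟩ := Sum.isLeft_iff.1 (hF m (by omega))
    have hi : i.val = 1 := by simpa [lab, e] using H.finish
    have hle := H.finish_le
    have key : ∃ i' : Fin (G.len + 3), i'.val = 2 ∧ ∃ b, l (m + 2) = .inl (t, i', b) := by
      have step : ∀ n < N, ∀ t i, l n = .inl (t, i, true) → i.val = 1 → (l (n + 1)).isLeft →
          ∃ i' : Fin (G.len + 3), i'.val = 2 ∧ l (n + 1) = .inl (t, i', false) := by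
        intro n hn t i h hi h'
        obtain ⟨t', i', e', h2 | h2⟩ := H.pre_of_post hn h h'
        · exact ⟨i', by omega, by rw [e', h2.1]⟩
        · omega
      cases b
      · have e1 := H.post_of_pre (by omega) e (hF (m + 1) (by omega))
        obtain ⟨i', h1, h2⟩ := step (m + 1) (by omega) t i e1 hi (hF (m + 2) (by omega))
        exact ⟨i', h1, _, h2⟩
      · obtain ⟨i', h1, h2⟩ := step m (by omega) t i e hi (hF (m + 1) (by omega))
        exact ⟨i', h1, _, H.post_of_pre (by omega) h2 (hF (m + 2) (by omega))⟩
    obtain ⟨i', h1, b, h2⟩ := key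
    have := H.finish_later
    simp [h2, lab, h1] at this
  obtain ⟨hF1, hF2⟩ := Nat.find_spec hex
  set F := Nat.find hex with hFdef
  have hF : ∀ n < F, (l n).isLeft := by
    intro n hn
    have h := Nat.find_min hex hn
    rcases h' : l n with x | b
    · rfl
    · cases b
      · exact absurd h' (hsink n (by omega))
      · exact absurd ⟨by omega, h'⟩ h
  have hFN : F ≤ N := hF1.trans H.finish_le
  have hF0 : F ≠ 0 := by
    intro h
    rw [h, H.loc_zero] at hF2
    simp [entry] at hF2
  obtain ⟨n, hn⟩ := Nat.exists_eq_succ_of_ne_zero hF0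
  rw [Nat.succ_eq_add_one] at hn
  have hall := H.allowed n (by omega)
  obtain ⟨J, r, hr, h | h⟩ := exists_pos (G := G) n
  · have e := H.loc_pre hFN hF J r hr (by omega)
    rw [h, e, ← h, ← hn, hF2] at hall
    simp [Allowed] at hall
  · have e := H.loc_post hFN hF J r hr (by omega)
    rw [h, e, ← h, ← hn, hF2] at hall
    obtain ⟨-, h1, h2⟩ := hall
    simp only at h1
    subst h1
    have : F = G.pos J 2 := by rw [hn, h, pos_succ J 1]
    exact ⟨J, this ▸ hF, this ▸ hF1, h2⟩

/-- The lower bound places `q` beyond block 1 of macro `j`. Macros `j` and `j + 1` together cost at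
least their fills, so the upper bound places `q` before macro `j + 2`. The only false labels in
between are the two in block 1 of macro `j + 1`. -/
theorem target (H : G.Accepted P l d c N m) {F : ℕ} (hFN : F ≤ N)
    (hF : ∀ n < F, (l n).isLeft) {j q : ℕ} (hj : G.pos (j + 2) 0 + 1 < F)
    (hq : G.lab (l q) = false)
    (h1 : G.cum P l d (G.pos j 0) + 2 * (P.unit + 1) < G.cum P l d q)
    (h2 : G.cum P l d q < G.cum P l d (G.pos j 0) + P.fill (G.mac l j) +
      P.fill (G.mac l (j + 1))) :
    q = G.pos (j + 1) 1 ∨ q = G.pos (j + 1) 1 + 1 := by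
  have hj1 := pos_add_two (G := G) j
  have hj2 : G.pos (j + 2) 0 = _ := pos_add_two (G := G) (j + 1)
  have e1 : G.pos j 1 = G.pos j 0 + 2 := pos_succ j 0
  have hlow : G.pos j 1 + 2 < q := by
    by_contra h
    have := G.cum_mono P l d (not_lt.1 h)
    rw [H.cum_block_pre hFN hF j 1 le_rfl (by omega), e1,
      H.cum_block_pre hFN hF j 0 (by omega) (by omega)] at this
    refine absurd this (not_le.2 (lt_of_eq_of_lt ?_ h1))
    ring
  have hhigh : q < G.pos (j + 2) 0 := by
    by_contra h
    have := G.cum_mono P l d (not_lt.1 h)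
    rw [H.cum_mac hFN hF (j + 1) hj, H.cum_mac hFN hF j (by omega)] at this
    refine absurd this (not_le.2 (lt_of_lt_of_le h2 ?_))
    rw [← NNReal.coe_le_coe]
    push_cast
    have p1 : (0:ℝ) ≤ G.up (G.mac l j) * d (G.pos j 1 + 1) := by positivity
    have p2 : (0:ℝ) ≤ (G.down (G.mac l j) + 1) * d (G.pos (j + 1) 0) := by positivity
    have p3 : (0:ℝ) ≤ G.up (G.mac l (j + 1)) * d (G.pos (j + 1) 1 + 1) := by positivity
    have p4 : (0:ℝ) ≤ (G.down (G.mac l (j + 1)) + 1) * d (G.pos (j + 1 + 1) 0) := by positivity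
    have p5 : (0:ℝ) ≤ P.unit := by positivity
    linarith
  obtain ⟨k, r, hr, h⟩ := exists_pos (G := G) q
  have hr1 : r = 1 := by
    rcases h with h | h
    · rw [h, H.loc_pre hFN hF k r hr (by omega)] at hq
      simpa [lab] using hq
    · rw [h, H.loc_post hFN hF k r hr (by omega)] at hq
      simpa [lab] using hq
  subst hr1
  have e2 : G.pos k 1 = G.pos k 0 + 2 := pos_succ k 0
  have hk : k = j + 1 := by
    rcases lt_trichotomy k (j + 1) with h' | h' | h'
    · have : G.pos k 0 ≤ G.pos j 0 := by
        rcases (Nat.lt_succ_iff.1 h').eq_or_lt with rfl | h''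
        · exact le_rfl
        · have a1 := pos_strictMono (G := G) h''
          have a2 := pos_add_two (G := G) k
          omega
      omega
    · exact h'
    · have := pos_strictMono (G := G) h'
      rw [show j + 1 + 1 = j + 2 by ring] at this
      omega
  subst hk
  exact h

/-- Locating a target needs the fill of the macro that contains it. Macro `J` is left after two
blocks and never pays its fill, so the link of macro `J - 1` may end in the final location and tells
nothing; hence the bound `J - 1`. -/
theorem exists_path (H : G.Accepted P l d c N m)
    (hfill : ∀ t t', P.gap + P.unit + 1 < P.fill t + P.fill t')
    (hin : P.input ≤ P.unit) :
    ∃ t u J, G.IsPath P t u J (J - 1) := by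
  obtain ⟨J, hF, hFm, hexit⟩ := H.exists_final
  have hFN : G.pos J 2 ≤ N := hFm.trans H.finish_le
  have hJ : ∀ j ≤ J, G.pos j 0 + 4 ≤ G.pos J 2 := by
    intro j hj
    have a2 := pos_add (G := G) J 2
    rcases hj.eq_or_lt with rfl | hj
    · omega
    · have a1 := pos_strictMono (G := G) hj
      have a3 := pos_add_two (G := G) j
      omega
  have p1 : ∀ j, G.pos j 1 = G.pos j 0 + 2 := fun j => pos_succ j 0
  have hle : ∀ j ≤ J, d (G.pos j 0) ≤ P.unit := by
    intro j hj
    have := hJ j hj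
    rw [← H.delay_add' hFN hF j 0 (by omega)]
    exact le_self_add
  have key : ∀ j, j + 2 ≤ J → d (G.pos (j + 1) 1) = d (G.pos j 0) ∧
      G.up (G.mac l j) * d (G.pos j 1 + 1) + (G.down (G.mac l j) + 1) * d (G.pos (j + 1) 0) +
        P.fill (G.mac l j) = P.total := by
    intro j hj
    have h0 := hJ j (by omega)
    have h1 := hJ (j + 1) (by omega)
    have h2 := hJ (j + 2) (by omega)
    have h01 := pos_add_two (G := G) j
    have h12 : G.pos (j + 2) 0 = _ := pos_add_two (G := G) (j + 1)
    have hfj : (P.gap : ℝ≥0) + P.unit + 1 < P.fill (G.mac l j) + P.fill (G.mac l (j + 1)) := by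
      exact_mod_cast hfill (G.mac l j) (G.mac l (j + 1))
    have hgap : (P.gap : ℝ≥0) = P.total + 3 * P.unit + 3 := by simp [Scale.gap]
    have l0 := H.loc_pre hFN hF j 0 (by omega) (by omega)
    have l1 := H.loc_post hFN hF j 0 (by omega) (by omega)
    have l2 := H.loc_pre hFN hF j 1 (by omega) (by rw [p1]; omega)
    have l3 := H.loc_post hFN hF j 1 (by omega) (by rw [p1]; omega)
    obtain ⟨q, q1, q2, q3, q4⟩ := H.link (G.pos j 0) (by omega) (by rw [l0]; rfl)
      (by rw [← p1, l2]; rfl)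
    obtain ⟨q', q1', q2', q3', q4'⟩ := H.link (G.pos j 0 + 1) (by omega) (by rw [l1]; rfl)
      (by rw [show G.pos j 0 + 1 + 2 = G.pos j 0 + 2 + 1 by ring, ← p1, l3]; rfl)
    rw [H.cum_event_pre hFN hF j 0 (by omega) (by omega)] at q4'
    have hv := hle j (by omega)
    have t1 := H.target hFN hF (j := j) (q := q) (by omega) q3
      (by
        rw [q4, hgap]
        gcongr
        rw [← NNReal.coe_lt_coe]
        push_cast
        have p5 : (0:ℝ) ≤ P.unit := by positivity
        have p6 : (0:ℝ) ≤ P.total := by positivity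
        linarith)
      (by
        rw [q4, add_assoc]
        gcongr
        refine lt_of_le_of_lt ?_ hfj
        rw [add_assoc]
        exact le_self_add)
    have t2 := H.target hFN hF (j := j) (q := q') (by omega) q3'
      (by
        rw [q4', hgap, ← NNReal.coe_lt_coe]
        push_cast
        have p5 : (0:ℝ) ≤ P.unit := by positivity
        have p6 : (0:ℝ) ≤ P.total := by positivity
        have p7 : (0:ℝ) ≤ d (G.pos j 0) := by positivity
        linarith)
      (by
        rw [← NNReal.coe_lt_coe] at hfj ⊢
        rw [← NNReal.coe_le_coe] at hv
        rw [q4']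
        push_cast at hv hfj ⊢
        linarith)
    -- The event transition costs 1, so the two starting positions, and hence the two targets,
    -- differ in cost even if the delay is zero.
    have hlt : q < q' := by
      by_contra h
      have := G.cum_mono P l d (not_lt.1 h)
      rw [q4, q4', ← NNReal.coe_le_coe] at this
      push_cast at this
      have p7 : (0:ℝ) ≤ d (G.pos j 0) := by positivity
      linarith
    have hq : q = G.pos (j + 1) 1 := by omega
    have hq' : q' = G.pos (j + 1) 1 + 1 := by omega
    subst hq hq'
    rw [H.cum_event_pre hFN hF (j + 1) 1 le_rfl (by rw [p1]; omega), q4] at q4'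
    rw [p1, H.cum_block_pre hFN hF (j + 1) 0 (by omega) (by omega),
      H.cum_mac hFN hF j (by omega), hgap] at q4
    refine ⟨?_, ?_⟩
    · rw [← NNReal.coe_inj] at q4' ⊢
      push_cast at q4'
      linarith
    · rw [← NNReal.coe_inj] at q4 ⊢
      push_cast at q4 ⊢
      linarith
  have h0 := hJ 0 (by omega)
  obtain ⟨z1, z2⟩ := H.event_zero hFN hF (by rw [p1]; omega)
  -- Register 0 appears only in block 1 of macro 0; register `j + 1` is the offset in block 0 of
  -- macro `j`.
  let u : ℕ → ℝ≥0 := fun j => Nat.casesOn j (d (G.pos 0 1)) fun j => d (G.pos j 0)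
  have hu : ∀ j, j < J - 1 → d (G.pos j 1) = u j := by
    intro j hj
    cases j with
    | zero => rfl
    | succ j => exact (key j (by omega)).1
  refine ⟨G.mac l, u, J, H.mac_zero, fun j hj => ?_, hexit, z2, z1, fun j hj => ?_,
    fun j hj => ?_⟩
  · have := hJ (j + 1) hj
    exact H.next_mac hFN hF j (by omega)
  · cases j with
    | zero =>
      change d (G.pos 0 1) ≤ _
      rw [z2]
      exact_mod_cast hin
    | succ j => exact hle j (by omega)
  · obtain ⟨-, k2⟩ := key j (by omega)
    have := hJ (j + 1) (by omega)
    have h01 := pos_add_two (G := G) j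
    have k3 := H.delay_add' hFN hF j 1 (by rw [p1]; omega)
    rw [← hu j hj, ← k2, ← k3]
    change _ * (d (G.pos j 1) + d (G.pos j 1 + 1)) + _ * d (G.pos (j + 1) 0) + _ = _
    ring

end Control.Accepted

/-! ### From paths of macros to traces -/

namespace Control

variable {T : Type} (G : Control T) (P : Scale T) (t : ℕ → T) (u : ℕ → ℝ≥0) (J : ℕ)

/-- The time of the event in the `r`-th block of the `j`-th macro of a path. -/
def event (j r : ℕ) : ℝ≥0 :=
  if r = 0 then u (j + 1) else if r < G.up (t j) + 2 then u j else u (j + 2)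

/-- The locations of the trace of a path. -/
def pathLoc (n : ℕ) : G.Loc :=
  if n < G.pos J 2 then
    .inl (t (n / 2 / (G.len + 3)),
      ⟨n / 2 % (G.len + 3), Nat.mod_lt _ (Nat.succ_pos _)⟩, n % 2 == 1)
  else .inr true

/-- The delays of the trace of a path. -/
noncomputable def pathDelay (n : ℕ) : ℝ≥0 :=
  if n < G.pos J 2 then
    let v := G.event t u (n / 2 / (G.len + 3)) (n / 2 % (G.len + 3))
    if n % 2 = 0 then v else P.unit - v
  else if n = G.pos J 2 then P.total + P.unit + 1 else u (J + 1) + 1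

/-- The clock valuations of the trace of a path. -/
noncomputable def pathClock : ℕ → Fin 2 → ℝ≥0
  | 0, _ => 0
  | n + 1, x =>
    if G.reset (G.pathLoc t J n) (G.pathLoc t J (n + 1)) x then 0
    else pathClock n x + G.pathDelay P t u J n

variable {G P t u J}

theorem pathClock_succ (n : ℕ) (x : Fin 2) : G.pathClock P t u J (n + 1) x =
    if G.reset (G.pathLoc t J n) (G.pathLoc t J (n + 1)) x then 0
    else G.pathClock P t u J n x + G.pathDelay P t u J n := rfl

theorem pos_div (j r : ℕ) (hr : r < G.len + 3) :
    G.pos j r / 2 / (G.len + 3) = j ∧ G.pos j r / 2 % (G.len + 3) = r ∧ G.pos j r % 2 = 0 ∧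
      (G.pos j r + 1) / 2 = G.pos j r / 2 ∧ (G.pos j r + 1) % 2 = 1 := by
  have h : G.pos j r / 2 = r + j * (G.len + 3) := by simp [pos]; omega
  refine ⟨?_, ?_, by simp [pos], by simp only [pos]; omega, by simp only [pos]; omega⟩
  · rw [h, Nat.add_mul_div_right _ _ (by omega), Nat.div_eq_of_lt hr, zero_add]
  · rw [h, Nat.add_mul_mod_self_right, Nat.mod_eq_of_lt hr]

theorem pathLoc_pre {j r : ℕ} (hr : r < G.len + 3) (h : G.pos j r < G.pos J 2) :
    G.pathLoc t J (G.pos j r) = .inl (t j, ⟨r, hr⟩, false) := by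
  obtain ⟨h1, h2, h3, -, -⟩ := pos_div (G := G) j r hr
  simp [pathLoc, h, h1, h2, h3]

theorem pathLoc_post {j r : ℕ} (hr : r < G.len + 3) (h : G.pos j r + 1 < G.pos J 2) :
    G.pathLoc t J (G.pos j r + 1) = .inl (t j, ⟨r, hr⟩, true) := by
  obtain ⟨h1, h2, -, h4, h5⟩ := pos_div (G := G) j r hr
  simp [pathLoc, h, h1, h2, h4, h5]

theorem pathLoc_final {n : ℕ} (h : G.pos J 2 ≤ n) : G.pathLoc t J n = .inr true := by
  simp [pathLoc, not_lt.2 h]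

theorem pathDelay_pre {j r : ℕ} (hr : r < G.len + 3) (h : G.pos j r < G.pos J 2) :
    G.pathDelay P t u J (G.pos j r) = G.event t u j r := by
  obtain ⟨h1, h2, h3, -, -⟩ := pos_div (G := G) j r hr
  simp [pathDelay, h, h1, h2, h3]

theorem pathDelay_post {j r : ℕ} (hr : r < G.len + 3) (h : G.pos j r + 1 < G.pos J 2) :
    G.pathDelay P t u J (G.pos j r + 1) = P.unit - G.event t u j r := by
  obtain ⟨h1, h2, -, h4, h5⟩ := pos_div (G := G) j r hr
  simp [pathDelay, h, h1, h2, h4, h5]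

theorem lt_of_pos_lt {j r : ℕ} (h : G.pos j r < G.pos J 2) : j < J ∨ (j = J ∧ r ≤ 1) := by
  have h1 := pos_add (G := G) j r
  have h2 := pos_add (G := G) J 2
  rcases lt_trichotomy j J with h' | rfl | h'
  · exact .inl h'
  · exact .inr ⟨rfl, by omega⟩
  · have := pos_strictMono (G := G) h'
    have := pos_add_two (G := G) J
    omega

/-- The block at a position before the end is followed by the next block of the same macro, by the
next macro, or by the end. -/
theorem pos_cases {j r : ℕ} (hr : r < G.len + 3) (h : G.pos j r < G.pos J 2) :
    (r + 1 < G.len + 3 ∧ G.pos j r + 2 = G.pos j (r + 1) ∧ G.pos j (r + 1) < G.pos J 2) ∨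
    (r = G.len + 2 ∧ G.pos j r + 2 = G.pos (j + 1) 0 ∧ G.pos (j + 1) 0 < G.pos J 2 ∧ j < J) ∨
    (r = 1 ∧ j = J ∧ G.pos j r + 2 = G.pos J 2) := by
  have h2 := pos_add (G := G) J 2
  have h3 := pos_add (G := G) j r
  rcases lt_of_pos_lt h with h' | ⟨rfl, h'⟩
  · have h4 := pos_strictMono (G := G) h'
    have h5 := pos_add_two (G := G) j
    by_cases h6 : r + 1 < G.len + 3
    · have := pos_succ (G := G) j r
      exact .inl ⟨h6, by omega, by omega⟩
    · obtain rfl : r = G.len + 2 := by omega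
      exact .inr (.inl ⟨rfl, (pos_succ_zero j).symm, by omega, h'⟩)
  · interval_cases r
    · exact .inl ⟨by omega, (pos_succ j 0).symm, by simp [pos]⟩
    · exact .inr (.inr ⟨rfl, rfl, (pos_succ j 1).symm⟩)

theorem pathClock_post {j r : ℕ} (hr : r < G.len + 3) (h : G.pos j r + 1 < G.pos J 2) :
    G.pathClock P t u J (G.pos j r + 1) 1 = 0 := by
  have h' : G.pos j r < G.pos J 2 := by omega
  simp [pathClock, pathLoc_pre hr h', pathLoc_post hr h, reset]

theorem pathClock_next {j r j' r' : ℕ} (hr : r < G.len + 3) (hr' : r' < G.len + 3)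
    (h : G.pos j r + 2 = G.pos j' r') (h' : G.pos j' r' < G.pos J 2) :
    G.pathClock P t u J (G.pos j' r') 0 = 0 ∧
      G.pathClock P t u J (G.pos j' r') 1 = P.unit - G.event t u j r := by
  have e := pathLoc_pre (t := t) hr' h'
  rw [← h] at e ⊢
  rw [show G.pos j r + 2 = G.pos j r + 1 + 1 from rfl] at e ⊢
  have hy := pathClock_post (P := P) (t := t) (u := u) hr (show G.pos j r + 1 < G.pos J 2 by omega)
  have e' := pathLoc_post (t := t) hr (show G.pos j r + 1 < G.pos J 2 by omega)
  simp [pathClock_succ (G.pos j r + 1), e, e', hy, reset,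
    pathDelay_post hr (show G.pos j r + 1 < G.pos J 2 by omega)]

theorem pathClock_x {j r : ℕ} (hr : r < G.len + 3) (h : G.pos j r < G.pos J 2) :
    G.pathClock P t u J (G.pos j r) 0 = 0 := by
  cases r with
  | zero =>
    cases j with
    | zero => simp [pos_zero, pathClock]
    | succ j => exact (pathClock_next (by omega) hr (pos_succ_zero j).symm h).1
  | succ r => exact (pathClock_next (by omega) hr (pos_succ j r).symm h).1

theorem pathClock_x_post {j r : ℕ} (hr : r < G.len + 3) (h : G.pos j r + 1 < G.pos J 2) :
    G.pathClock P t u J (G.pos j r + 1) 0 = G.event t u j r := by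
  simp [pathClock, pathLoc_pre hr (show G.pos j r < G.pos J 2 by omega), pathLoc_post hr h,
    reset, pathClock_x hr (show G.pos j r < G.pos J 2 by omega),
    pathDelay_pre hr (show G.pos j r < G.pos J 2 by omega)]

theorem pos_pre_lt {j r : ℕ} (h : G.pos j r < G.pos J 2) : G.pos j r + 1 < G.pos J 2 := by
  simp only [pos] at *; omega

theorem IsPath.event_le {K : ℕ} (H : G.IsPath P t u J K) {j r : ℕ}
    (h : G.pos j r < G.pos J 2) : G.event t u j r ≤ P.unit := by
  have := lt_of_pos_lt h
  unfold event
  split_ifs with h1 h2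
  · exact H.le_unit _ (by omega)
  · exact H.le_unit _ (by omega)
  · exact H.le_unit _ (by omega)

/-- The prescribed offset changes only on entering block 1 and on entering the guessing block, which
are the blocks that do not test clock 1; the start macro has its own tests in blocks 0 and 1. -/
theorem IsPath.eventGuard {K : ℕ} (H : G.IsPath P t u J K) {j r : ℕ} (hr : r < G.len + 3)
    (h : G.pos j r < G.pos J 2) :
    (G.eventGuard P (t j) r).Sat
      fun x => G.pathClock P t u J (G.pos j r) x + G.event t u j r := by
  have hx := pathClock_x (P := P) (t := t) (u := u) hr h
  have hlt := lt_of_pos_lt h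
  have hne : ∀ j, j < J → t (j + 1) ≠ G.start := fun j hj e =>
    G.not_next_start _ (e ▸ H.next j hj)
  have hsub : ∀ v : ℝ≥0, v ≤ P.unit → P.unit - v + v = P.unit := fun v hv =>
    tsub_add_cancel_of_le hv
  rcases r with _ | _ | g
  · cases j with
    | zero =>
      simp [Control.eventGuard, H.start, ClockConstraint.Sat, Cmp.Holds, hx, event, H.one]
    | succ j =>
      have hy := (pathClock_next (P := P) (t := t) (u := u) (by omega) hr
        (pos_succ_zero j).symm h).2
      -- Since `up ≤ len`, the last block of a macro does not come before the guess, so it already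
      -- has the offset that the next macro inherits.
      have hu := G.up_add_down_le (t j)
      simp only [Control.eventGuard, if_true, hne j (by omega), if_false, ClockConstraint.Sat,
        Cmp.Holds, hy]
      simp only [event, if_true, if_false, show ¬ G.len + 2 = 0 by omega,
        show ¬ G.len + 2 < G.up (t j) + 2 by omega]
      exact hsub _ (H.le_unit _ (by omega))
  · cases j with
    | zero =>
      simp [Control.eventGuard, H.start, ClockConstraint.Sat, Cmp.Holds, hx, event, H.zero]
    | succ j =>
      simp [Control.eventGuard, hne j (by omega), ClockConstraint.Sat, Cmp.Holds]
  · by_cases hg : g = G.up (t j)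
    · simp [Control.eventGuard, hg, ClockConstraint.Sat, Cmp.Holds]
    · have hy := (pathClock_next (P := P) (t := t) (u := u) (by omega) hr
        (pos_succ j (g + 1)).symm h).2
      have e : G.event t u j (g + 1) = G.event t u j (g + 2) := by
        simp only [event, show ¬ g + 1 = 0 by omega, show ¬ g + 2 = 0 by omega, if_false]
        by_cases h3 : g < G.up (t j)
        · rw [if_pos (by omega), if_pos (by omega)]
        · rw [if_neg (by omega), if_neg (by omega)]
      simp only [Control.eventGuard, show ¬ g + 1 + 1 = 0 by omega,
        show ¬ g + 1 + 1 = 1 by omega, show ¬ g + 1 + 1 = G.up (t j) + 2 by omega,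
        if_false, ClockConstraint.Sat, Cmp.Holds, hy, e]
      exact hsub _ (H.event_le h)

theorem IsPath.isTrace {K : ℕ} (H : G.IsPath P t u J K) :
    G.IsTrace P (G.pathLoc t J) (G.pathDelay P t u J) (G.pathClock P t u J) (G.pos J 2 + 2) := by
  have key : ∀ n, G.Allowed (G.pathLoc t J n) (G.pathLoc t J (n + 1)) ∧
      (G.guard P (G.pathLoc t J n) (G.pathLoc t J (n + 1))).Sat
        (fun x => G.pathClock P t u J n x + G.pathDelay P t u J n) := by
    intro n
    by_cases hn : n < G.pos J 2
    · obtain ⟨j, r, hr, rfl | rfl⟩ := exists_pos (G := G) n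
      · have h' := pos_pre_lt hn
        rw [pathLoc_pre hr hn, pathLoc_post hr h', pathDelay_pre hr hn]
        exact ⟨⟨rfl, rfl, rfl⟩, H.eventGuard hr hn⟩
      · have hx : G.pathClock P t u J (G.pos j r + 1) 0 +
            G.pathDelay P t u J (G.pos j r + 1) = P.unit := by
          rw [pathClock_x_post hr hn, pathDelay_post hr hn]
          exact add_tsub_cancel_of_le (H.event_le (by omega))
        rw [pathLoc_post hr hn]
        rcases pos_cases hr (show G.pos j r < G.pos J 2 by omega) with
          ⟨h1, h2, h3⟩ | ⟨h1, h2, h3, h4⟩ | ⟨rfl, rfl, h1⟩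
        · rw [show G.pos j r + 1 + 1 = G.pos j (r + 1) from h2, pathLoc_pre h1 h3]
          exact ⟨⟨rfl, .inl ⟨rfl, rfl⟩⟩, hx⟩
        · rw [show G.pos j r + 1 + 1 = G.pos (j + 1) 0 from h2, pathLoc_pre (by omega) h3]
          exact ⟨⟨rfl, .inr ⟨h1, rfl, H.next j h4⟩⟩, hx⟩
        · rw [pathLoc_final (le_of_eq h1.symm)]
          exact ⟨⟨rfl, rfl, H.exit⟩, hx⟩
    · rw [pathLoc_final (not_lt.1 hn), pathLoc_final (by omega)]
      exact ⟨trivial, by simp [guard, ClockConstraint.Sat, Cmp.Holds]⟩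
  refine ⟨?_, fun x => rfl, fun n _ => (key n).1, fun n _ => (key n).2, fun n _ x => rfl⟩
  have : G.pos 0 0 < G.pos J 2 := by simp only [pos]; omega
  have e := pathLoc_pre (t := t) (by omega) this
  rw [pos_zero] at e
  rw [e, H.start]
  rfl

/-- For `j < J` the register equation makes the links from block 0 of macro `j` end in block 1 of
macro `j + 1`. Macro `J` has no successor; its two links end in the final location, where the slope
is 1 and the delays are chosen to fit. -/
theorem IsPath.accepted (H : G.IsPath P t u J J) :
    G.Accepted P (G.pathLoc t J) (G.pathDelay P t u J) (G.pathClock P t u J)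
      (G.pos J 2 + 2) (G.pos J 1) := by
  have hT := H.isTrace
  have hF : ∀ n < G.pos J 2, (G.pathLoc t J n).isLeft := by
    intro n hn
    simp [pathLoc, hn]
  have hFN : G.pos J 2 ≤ G.pos J 2 + 2 := by omega
  have p1 : ∀ j, G.pos j 1 = G.pos j 0 + 2 := fun j => pos_succ j 0
  have p2 : G.pos J 2 = G.pos J 0 + 4 := pos_add J 2
  have hmac : ∀ j ≤ J, G.pos j 0 + 4 ≤ G.pos J 2 := by
    intro j hj
    rcases hj.eq_or_lt with rfl | hj
    · omega
    · have a1 := pos_strictMono (G := G) hj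
      have a3 := pos_add_two (G := G) j
      omega
  have hmac' : ∀ j ≤ J, G.mac (G.pathLoc t J) j = t j := by
    intro j hj
    have := hmac j hj
    rw [mac, pathLoc_pre (by omega) (by omega)]
  have hgap : (P.gap : ℝ≥0) = P.total + 3 * P.unit + 3 := by simp [Scale.gap]
  have hv : ∀ j ≤ J, G.pathDelay P t u J (G.pos j 0) = u (j + 1) := by
    intro j hj
    have := hmac j hj
    rw [pathDelay_pre (by omega) (by omega)]
    simp [event]
  have he : ∀ j ≤ J, G.pathDelay P t u J (G.pos j 1) = u j := by
    intro j hj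
    have := hmac j hj
    rw [pathDelay_pre (by omega) (by rw [p1]; omega)]
    simp [event]
  have hcum : ∀ j < J, G.cum P (G.pathLoc t J) (G.pathDelay P t u J) (G.pos (j + 1) 1) =
      G.cum P (G.pathLoc t J) (G.pathDelay P t u J) (G.pos j 0) + P.gap := by
    intro j hj
    have h1 := hmac (j + 1) hj
    have h2 := hmac j hj.le
    have h3 := pos_add_two (G := G) j
    rw [p1, hT.cum_block_pre hFN hF (j + 1) 0 (by omega) (by omega),
      hT.cum_mac hFN hF j (by omega), hmac' j hj.le, hv (j + 1) hj, hgap]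
    have h4 := H.eq j hj
    have h5 := hT.delay_add' hFN hF j 1 (by rw [p1]; omega)
    rw [he j hj.le] at h5
    rw [← NNReal.coe_inj] at h4 h5 ⊢
    push_cast at h4 h5 ⊢
    rw [← h5] at h4 ⊢
    linarith
  have hfin : G.cum P (G.pathLoc t J) (G.pathDelay P t u J) (G.pos J 2) =
      G.cum P (G.pathLoc t J) (G.pathDelay P t u J) (G.pos J 0) + 2 * P.unit + 2 := by
    have h1 : u J + G.pathDelay P t u J (G.pos J 1 + 1) = P.unit := by
      rw [pathDelay_post (by omega) (by rw [p1]; omega)]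
      simp only [event, one_ne_zero, if_false, show 1 < G.up (t J) + 2 by omega, if_true]
      exact add_tsub_cancel_of_le (H.le_unit J (by omega))
    rw [show G.pos J 2 = G.pos J 1 + 1 + 1 from pos_succ J 1, cum_succ,
      hT.cum_event_pre hFN hF J 1 le_rfl (by rw [p1]; omega), p1,
      hT.cum_block_pre hFN hF J 0 (by omega) (by omega), ← p1, he J le_rfl,
      pathLoc_post (by omega) (by rw [p1]; omega), pathLoc_final (le_of_eq (pos_succ J 1))]
    simp only [rate, gain, show 1 < G.up (t J) + 2 by omega, if_true]
    rw [← h1]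
    push_cast
    ring
  refine ⟨hT, ?_, ?_, ?_, ?_⟩
  · rw [pathLoc_pre (by omega) (by rw [p1]; omega)]; rfl
  · rw [p1]; omega
  · rw [← pos_succ, pathLoc_final le_rfl]; rfl
  · intro n hn e1 e2
    obtain ⟨j, r, hr, hnr⟩ := exists_pos (G := G) n
    have hlt : G.pos j r < G.pos J 2 := by
      rw [p1] at hn; omega
    -- A false label two positions later means that the next block is block 1. The other
    -- possibility, that the blocks end there, is excluded by `n < G.pos J 1`.
    have hr0 : r = 0 := by
      have hpl := pos_pre_lt hlt
      rcases pos_cases hr hlt with ⟨h1, h2, h3⟩ | ⟨h1, h2, h3, h4⟩ | ⟨rfl, rfl, h1⟩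
      · have h3' := pos_pre_lt h3
        rcases hnr with rfl | rfl
        · rw [h2, pathLoc_pre h1 h3] at e2
          simpa [lab] using e2
        · rw [show G.pos j r + 1 + 2 = G.pos j (r + 1) + 1 by omega,
            pathLoc_post h1 h3'] at e2
          simpa [lab] using e2
      · have h3' := pos_pre_lt h3
        rcases hnr with rfl | rfl
        · rw [h2, pathLoc_pre (by omega) h3] at e2
          simp [lab] at e2
        · rw [show G.pos j r + 1 + 2 = G.pos (j + 1) 0 + 1 by omega,
            pathLoc_post (by omega) h3'] at e2
          simp [lab] at e2
      · omega
    subst hr0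
    have hjJ : j ≤ J := by rcases lt_of_pos_lt hlt with h | h <;> omega
    have hj4 := hmac j hjJ
    have hS := hT.cum_event_pre hFN hF j 0 (by omega) (by omega)
    rw [hv j hjJ] at hS
    rcases hjJ.eq_or_lt with rfl | hjJ
    · have f1 : G.cum P (G.pathLoc t j) (G.pathDelay P t u j) (G.pos j 2 + 1) =
          G.cum P (G.pathLoc t j) (G.pathDelay P t u j) (G.pos j 0) + P.gap := by
        rw [cum_succ, hfin, pathLoc_final le_rfl, pathLoc_final (by omega), hgap]
        simp [rate, gain, pathDelay]
        ring
      rcases hnr with rfl | rfl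
      · exact ⟨G.pos j 2 + 1, by omega, by omega, by rw [pathLoc_final (by omega)]; rfl, f1⟩
      · refine ⟨G.pos j 2 + 2, by omega, by omega, by rw [pathLoc_final (by omega)]; rfl, ?_⟩
        rw [cum_succ, f1, pathLoc_final (by omega), pathLoc_final (by omega), hS]
        simp [rate, gain, pathDelay]
        ring
    · have h1 := hmac (j + 1) hjJ
      have h3 := pos_add_two (G := G) j
      rcases hnr with rfl | rfl
      · refine ⟨G.pos (j + 1) 1, by rw [p1]; omega, by rw [p1]; omega, ?_, hcum j hjJ⟩
        rw [pathLoc_pre (by omega) (by rw [p1]; omega)]; rfl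
      · refine ⟨G.pos (j + 1) 1 + 1, by rw [p1]; omega, by rw [p1]; omega, ?_, ?_⟩
        · rw [pathLoc_post (by omega) (by rw [p1]; omega)]; rfl
        · rw [hT.cum_event_pre hFN hF (j + 1) 1 le_rfl (by rw [p1]; omega), hcum j hjJ,
            he (j + 1) hjJ, hS]
          ring

end Control

/-! ### Turing machines as control graphs -/

open Turing

/-! ### Half tapes as numbers in the unit interval. -/

namespace Digit

variable {Γ : Type} [Fintype Γ]

variable (Γ) in
/-- The base of the encoding of half tapes. -/
def base : ℕ := 2 * Fintype.card Γ + 2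

theorem base_pos : (0 : ℝ≥0) < base Γ := by
  have : 0 < base Γ := by simp [base]
  exact_mod_cast this

variable [Inhabited Γ]

open Classical in
/-- The digit of a symbol. The digit of the blank is zero, and distinct digits differ at least by
two. -/
noncomputable def digit (a : Γ) : ℕ := if a = default then 0 else 2 * (Fintype.equivFin Γ a + 1)

theorem digit_default : digit (default : Γ) = 0 := by simp [digit]

theorem digit_add_two_le (a : Γ) : digit a + 2 ≤ base Γ := by
  have := (Fintype.equivFin Γ a).2
  unfold digit base
  split_ifs <;> omega

/-- The digits of non-blank symbols are even and positive, so distinct digits are at least two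
apart. This margin allows remainders anywhere in the closed unit interval. -/
theorem eq_of_digit_le {a b : Γ} (h1 : digit a ≤ digit b + 1) (h2 : digit b ≤ digit a + 1) :
    a = b := by
  unfold digit at h1 h2
  split_ifs at h1 h2 with ha hb hb
  · rw [ha, hb]
  · omega
  · omega
  · exact (Fintype.equivFin Γ).injective (Fin.ext (by omega))

/-- The number in the unit interval whose expansion is a given list of symbols. -/
noncomputable def listValue : List Γ → ℝ≥0
  | [] => 0
  | a :: l => (listValue l + digit a) / base Γ

theorem listValue_append_blank (l : List Γ) (n : ℕ) :
    listValue (l ++ List.replicate n default) = listValue l := by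
  induction l with
  | nil =>
    induction n with
    | zero => rfl
    | succ n ih =>
      rw [List.nil_append] at ih ⊢
      simp [List.replicate_succ, listValue, ih, digit_default]
  | cons a l ih => simp [listValue, ih]

/-- The number in the unit interval whose expansion is a given half tape. -/
noncomputable def value (l : ListBlank Γ) : ℝ≥0 :=
  l.liftOn listValue (by rintro a b ⟨n, rfl⟩; exact (listValue_append_blank a n).symm)

theorem value_mk (l : List Γ) : value (ListBlank.mk l) = listValue l := rfl

theorem base_mul_value_cons (a : Γ) (l : ListBlank Γ) :
    base Γ * value (l.cons a) = value l + digit a := by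
  refine l.induction_on fun l => ?_
  rw [ListBlank.cons_mk, value_mk, value_mk, listValue, mul_div_cancel₀ _ base_pos.ne']

theorem value_le_one (l : ListBlank Γ) : value l ≤ 1 := by
  refine l.induction_on fun l => ?_
  rw [value_mk]
  induction l with
  | nil => simp [listValue]
  | cons a l ih =>
    rw [listValue, div_le_one base_pos]
    have : (digit a + 2 : ℝ≥0) ≤ base Γ := by exact_mod_cast digit_add_two_le a
    calc listValue l + (digit a : ℝ≥0) ≤ 1 + digit a := by gcongr
      _ ≤ digit a + 2 := by rw [add_comm]; gcongr; norm_num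
      _ ≤ _ := this

end Digit

open Digit

/-! ### Push and pop as affine equations. -/

namespace TapeOp

variable {Γ : Type}

variable (Γ) in
/-- Operations on a half tape: nothing, push, or pop. -/
abbrev Op : Type := Option (Γ ⊕ Γ)

/-- The effect of an operation. -/
def OpRel [Inhabited Γ] : Op Γ → ListBlank Γ → ListBlank Γ → Prop
  | none, l, l' => l' = l
  | some (.inl a), l, l' => l' = l.cons a
  | some (.inr a), l, l' => l = l'.cons a

variable [Fintype Γ]

/-- The number of blocks by which an operation scales up. -/
def up : Op Γ → ℕ
  | some (.inr _) => base Γ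
  | _ => 1

/-- The number of blocks by which an operation scales down. -/
def down : Op Γ → ℕ
  | some (.inl _) => base Γ - 1
  | _ => 0

/-- The shift of an operation. -/
noncomputable def shift [Inhabited Γ] : Op Γ → ℕ
  | none => 1
  | some (.inl a) => 1 + digit a
  | some (.inr a) => base Γ - digit a

theorem up_add_down_le (o : Op Γ) : up o + down o ≤ base Γ := by
  rcases o with _ | a | a <;> simp [up, down, base]; try omega

variable [Inhabited Γ]

theorem shift_le (o : Op Γ) : shift o ≤ base Γ := by
  rcases o with _ | a | a
  · simp [shift, base]
  · have := digit_add_two_le a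
    simp only [shift]; omega
  · simp [shift]

/-- The equation between the contents of a register before and after an operation. -/
def Evolves (U : ℕ) (o : Op Γ) (x y : ℝ≥0) : Prop :=
  up o * (U : ℝ≥0) + (down o + 1) * y = shift o * U + up o * x

/-- A push is y = (x + digit·U)/base and a pop is y = base·x - digit·U; clearing denominators and
adding multiples of U gives `Evolves`. -/
theorem OpRel.evolves {o : Op Γ} {l l' : ListBlank Γ} (h : OpRel o l l') (U : ℕ) :
    Evolves U o (U * value l) (U * value l') := by
  have hb : 1 ≤ base Γ := by simp [base]
  rcases o with _ | a | a
  · simp only [OpRel] at h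
    simp [Evolves, up, down, shift, h]
  · simp only [OpRel] at h
    have := base_mul_value_cons a l
    subst h
    simp only [Evolves, up, down, shift]
    rw [← NNReal.coe_inj] at this ⊢
    simp only [NNReal.coe_add, NNReal.coe_mul, NNReal.coe_natCast, NNReal.coe_one,
      Nat.cast_add, Nat.cast_one, Nat.cast_sub hb] at this ⊢
    linear_combination (U : ℝ) * this
  · simp only [OpRel] at h
    have := base_mul_value_cons a l'
    have ha : digit a ≤ base Γ := by have := digit_add_two_le a; omega
    subst h
    simp only [Evolves, up, down, shift]
    rw [← NNReal.coe_inj] at this ⊢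
    simp only [NNReal.coe_add, NNReal.coe_mul, NNReal.coe_natCast, NNReal.coe_one, NNReal.coe_zero,
      Nat.cast_zero, Nat.cast_sub ha] at this ⊢
    linear_combination (-(U : ℝ)) * this

/-- The converse needs `y ≤ U`, which holds for every offset in a block. Without it a pop could name
a wrong symbol. -/
theorem Evolves.exists_rel {U : ℕ} (hU : 0 < U) {o : Op Γ} {l : ListBlank Γ} {y : ℝ≥0}
    (h : Evolves U o (U * value l) y) (hy : y ≤ U) : ∃ l', OpRel o l l' ∧ y = U * value l' := by
  have hb : 1 ≤ base Γ := by simp [base]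
  have hb0 : (base Γ : ℝ) ≠ 0 := by exact_mod_cast (by omega : base Γ ≠ 0)
  have hU' : (0 : ℝ) < U := by exact_mod_cast hU
  rcases o with _ | a | a
  · refine ⟨l, rfl, ?_⟩
    simpa [Evolves, up, down, shift] using h
  · refine ⟨_, rfl, ?_⟩
    have := base_mul_value_cons a l
    simp only [Evolves, up, down, shift] at h
    rw [← NNReal.coe_inj] at this h ⊢
    simp only [NNReal.coe_add, NNReal.coe_mul, NNReal.coe_natCast, NNReal.coe_one,
      Nat.cast_add, Nat.cast_one, Nat.cast_sub hb] at this h ⊢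
    apply mul_left_cancel₀ hb0
    linear_combination h - (U : ℝ) * this
  · obtain ⟨b, l', rfl⟩ := l.exists_cons
    have := base_mul_value_cons b l'
    have ha : digit a ≤ base Γ := by have := digit_add_two_le a; omega
    simp only [Evolves, up, down, shift] at h
    have h1 := value_le_one l'
    rw [← NNReal.coe_inj] at this h
    rw [← NNReal.coe_le_coe] at h1 hy
    simp only [NNReal.coe_add, NNReal.coe_mul, NNReal.coe_natCast, NNReal.coe_one, NNReal.coe_zero,
      Nat.cast_zero, Nat.cast_sub ha] at this h h1 hy
    have h0 := (value l').coe_nonneg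
    have hy0 := y.coe_nonneg
    have key : (y : ℝ) + U * digit a = U * (value l' + digit b) := by
      linear_combination h + (U : ℝ) * this
    -- By `key`, digit a + y/U = digit b + value l'. Both remainders lie in [0,1], so the digits
    -- differ by at most one.
    have hab : a = b := by
      refine eq_of_digit_le ?_ ?_
      · have : (digit a : ℝ) ≤ digit b + 1 := by
          refine le_of_mul_le_mul_left ?_ hU'
          nlinarith
        exact_mod_cast this
      · have : (digit b : ℝ) ≤ digit a + 1 := by
          refine le_of_mul_le_mul_left ?_ hU'
          nlinarith
        exact_mod_cast this
    subst hab
    refine ⟨l', rfl, ?_⟩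
    rw [← NNReal.coe_inj]
    push_cast
    linarith

end TapeOp

open TapeOp

/-! ### Turing machine computations as paths of macros. -/

namespace TapeControl

variable {Γ Λ : Type} [Inhabited Γ] [Inhabited Λ]

variable (Γ Λ) in
/-- The phases of the simulation of a Turing machine: halted (`none`), at a configuration, or
between the operations on the left and on the right half of the tape. -/
abbrev Phase : Type := Option ((Λ × Γ) ⊕ (Λ × Γ × Op Γ))

/-- The operations that simulate a Turing machine. -/
inductive Valid (M : TM0.Machine Γ Λ) : Phase Γ Λ → Op Γ → Phase Γ Λ → Prop
  | write {q a q' b} (h : M q a = some (q', .write b)) :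
      Valid M (some (.inl (q, a))) none (some (.inr (q', b, none)))
  | right {q a q'} (h : M q a = some (q', .move .right)) (b : Γ) :
      Valid M (some (.inl (q, a))) (some (.inl a)) (some (.inr (q', b, some (.inr b))))
  | left {q a q'} (h : M q a = some (q', .move .left)) (b : Γ) :
      Valid M (some (.inl (q, a))) (some (.inr b)) (some (.inr (q', b, some (.inl a))))
  | second (q a o) : Valid M (some (.inr (q, a, o))) o (some (.inl (q, a)))
  | halt {q a} (h : M q a = none) : Valid M (some (.inl (q, a))) none none
  | stay : Valid M none none none

variable (Γ Λ) in
/-- The macros: the start, or an operation between two phases. -/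
abbrev Macro : Type := Option (Phase Γ Λ × Op Γ × Phase Γ Λ)

/-- The operation of a macro. -/
def op : Macro Γ Λ → Op Γ
  | none => none
  | some (_, o, _) => o

/-- The phase after a macro, where `a` is the first symbol of the input. -/
def target (a : Γ) : Macro Γ Λ → Phase Γ Λ
  | none => some (.inl (default, a))
  | some (_, _, s) => s

theorem dom_of_reaches {M : TM0.Machine Γ Λ} {c : TM0.Cfg Γ Λ} {q : Λ} {b : Γ} {L R : ListBlank Γ}
    (h : StateTransition.Reaches (TM0.step M) c ⟨q, ⟨b, L, R⟩⟩) (hM : M q b = none) :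
    (StateTransition.eval (TM0.step M) c).Dom :=
  Part.dom_iff_mem.2 ⟨_, StateTransition.mem_eval.2 ⟨h, by simp [TM0.step, hM]⟩⟩

section

variable [Fintype Γ] (M : TM0.Machine Γ Λ) (a : Γ)

/-- The control graph of a Turing machine. -/
def control : Control (Macro Γ Λ) where
  start := none
  next t t' := ∃ o s, t' = some (target a t, o, s) ∧ Valid M (target a t) o s
  exit t := ∃ o s, t = some (none, o, s)
  up t := TapeOp.up (op t)
  down t := TapeOp.down (op t)
  len := base Γ
  up_add_down_le _ := TapeOp.up_add_down_le _
  not_next_start := by simp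

variable (Γ Λ) in
/-- The constants for the control graph of a Turing machine. -/
noncomputable def scale (U V : ℕ) : Scale (Macro Γ Λ) where
  unit := U
  input := V
  total := 10 * base Γ * U
  fill t := (10 * base Γ - shift (op t)) * U

variable {M a}

/-- The fill is total - shift·U, so the total cancels. Its size matters only for locating the
targets of links. -/
theorem evolves_iff {U V : ℕ} {t : Macro Γ Λ} {x y : ℝ≥0} :
    (control M a).up t * ((scale Γ Λ U V).unit : ℝ≥0) + ((control M a).down t + 1) * y +
      (scale Γ Λ U V).fill t = (scale Γ Λ U V).total + (control M a).up t * x ↔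
    Evolves U (op t) x y := by
  have h : shift (op t) ≤ 10 * base Γ := by have := shift_le (op t); omega
  simp only [Evolves, control, scale]
  rw [← NNReal.coe_inj, ← NNReal.coe_inj]
  simp only [NNReal.coe_add, NNReal.coe_mul, NNReal.coe_natCast, NNReal.coe_one, Nat.cast_mul,
    Nat.cast_sub h]
  push_cast
  constructor <;> intro e <;> linear_combination e

/-- What the phase and the registers say about the computation. -/
def Sound (M : TM0.Machine Γ Λ) (c : TM0.Cfg Γ Λ) (U : ℕ) : Phase Γ Λ → ℝ≥0 → ℝ≥0 → Prop
  | none, _, _ => (StateTransition.eval (TM0.step M) c).Dom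
  | some (.inl (q, a)), x, y => ∃ L R, x = U * value L ∧ y = U * value R ∧
      StateTransition.Reaches (TM0.step M) c ⟨q, ⟨a, L, R⟩⟩
  | some (.inr (q, a, o)), x, y => ∃ L R, x = U * value R ∧ y = U * value L ∧
      ∀ R', OpRel o R R' → StateTransition.Reaches (TM0.step M) c ⟨q, ⟨a, L, R'⟩⟩

/-- The registers change places after each macro. The first macro of a Turing step treats the left
half and guesses the new head symbol where the move needs one; in between, `Sound` promises the step
only for those right halves that the pending operation can produce, and the second macro supplies
one. -/
theorem Sound.step {c : TM0.Cfg Γ Λ} {U : ℕ} (hU : 0 < U) {s s' : Phase Γ Λ} {o : Op Γ}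
    {x y z : ℝ≥0} (h : Sound M c U s x y) (hv : Valid M s o s') (hz : z ≤ U)
    (hb : Evolves U o x z) : Sound M c U s' y z := by
  have tail {q q' b b' L L' R R'} (h : StateTransition.Reaches (TM0.step M) c ⟨q, ⟨b, L, R⟩⟩)
      (e : TM0.step M ⟨q, ⟨b, L, R⟩⟩ = some ⟨q', ⟨b', L', R'⟩⟩) :
      StateTransition.Reaches (TM0.step M) c ⟨q', ⟨b', L', R'⟩⟩ := Relation.ReflTransGen.tail h e
  cases hv with
  | write hM =>
    obtain ⟨L, R, rfl, rfl, h⟩ := h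
    obtain ⟨L', h1, rfl⟩ := hb.exists_rel hU hz
    refine ⟨L', R, rfl, rfl, fun R' h2 => tail h ?_⟩
    simp only [OpRel] at h1 h2
    simp [TM0.step, hM, h1, h2, Tape.write]
  | right hM b =>
    obtain ⟨L, R, rfl, rfl, h⟩ := h
    obtain ⟨L', h1, rfl⟩ := hb.exists_rel hU hz
    refine ⟨L', R, rfl, rfl, fun R' h2 => tail h ?_⟩
    simp only [OpRel] at h1 h2
    simp [TM0.step, hM, h1, h2, Tape.move]
  | left hM b =>
    obtain ⟨L, R, rfl, rfl, h⟩ := h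
    obtain ⟨L', h1, rfl⟩ := hb.exists_rel hU hz
    refine ⟨L', R, rfl, rfl, fun R' h2 => tail h ?_⟩
    simp only [OpRel] at h1 h2
    simp [TM0.step, hM, h1, h2, Tape.move]
  | second q b o =>
    obtain ⟨L, R, rfl, rfl, h⟩ := h
    obtain ⟨R', h1, rfl⟩ := hb.exists_rel hU hz
    exact ⟨L, R', rfl, rfl, h R' h1⟩
  | halt hM =>
    obtain ⟨L, R, -, -, h⟩ := h
    exact dom_of_reaches h hM
  | stay => exact h

/-- The phase and the registers lead to the halted phase. -/
inductive Leads (M : TM0.Machine Γ Λ) (U : ℕ) : Phase Γ Λ → ℝ≥0 → ℝ≥0 → Prop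
  | halted {x y : ℝ≥0} (hx : x ≤ U) (hy : y ≤ U) : Leads M U none x y
  | step {s s' o} {x y z : ℝ≥0} (hv : Valid M s o s') (hx : x ≤ U) (hy : y ≤ U) (hb : Evolves U o x z)
      (h : Leads M U s' y z) : Leads M U s x y

theorem mul_value_le (U : ℕ) (l : ListBlank Γ) : (U : ℝ≥0) * value l ≤ U :=
  mul_le_of_le_one_right' (value_le_one l)

/-- Induction backwards from the halting configuration. Each step becomes two macros, where the
guessed symbol is the actual head of the half tape that is popped. -/
theorem leads_of_dom {c : TM0.Cfg Γ Λ} (h : (StateTransition.eval (TM0.step M) c).Dom) (U : ℕ) :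
    Leads M U (some (.inl (c.q, c.Tape.head))) (U * value c.Tape.left)
      (U * value c.Tape.right) := by
  obtain ⟨c', hc⟩ := Part.dom_iff_mem.1 h
  obtain ⟨h1, h2⟩ := StateTransition.mem_eval.1 hc
  clear h hc
  induction h1 using Relation.ReflTransGen.head_induction_on with
  | refl =>
    obtain ⟨q, b, L, R⟩ := c'
    have hM : M q b = none := by simpa [TM0.step] using h2
    exact .step (.halt hM) (mul_value_le U L) (mul_value_le U R)
      (OpRel.evolves (l := L) (o := none) rfl U) (.halted (mul_value_le U R) (mul_value_le U L))
  | @head c c₁ h1 _ ih =>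
    obtain ⟨q, b, L, R⟩ := c
    obtain ⟨⟨q', s⟩, hM, rfl⟩ := Option.map_eq_some_iff.1 h1
    have two {o o' b' L' R'} (hv : Valid M (some (.inl (q, b))) o (some (.inr (q', b', o'))))
        (r1 : OpRel o L L') (r2 : OpRel o' R R')
        (h : Leads M U (some (.inl (q', b'))) (U * value L') (U * value R')) :
        Leads M U (some (.inl (q, b))) (U * value L) (U * value R) :=
      .step hv (mul_value_le U L) (mul_value_le U R) (r1.evolves U)
        (.step (.second q' b' o') (mul_value_le U R) (mul_value_le U L') (r2.evolves U) h)
    rcases s with (_ | _) | b'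
    · exact two (.left hM L.head) (ListBlank.cons_head_tail L).symm rfl ih
    · exact two (.right hM R.head) rfl (ListBlank.cons_head_tail R).symm ih
    · exact two (.write hM) rfl rfl ih

/-- Macros are prepended in the induction, so the path begins with a given earlier macro `t₀` that
consumes `w`. The equation of `t₀` itself is left to the caller. -/
theorem Leads.exists_path {U : ℕ} {s : Phase Γ Λ} {x y : ℝ≥0} (h : Leads M U s x y)
    (t₀ : Macro Γ Λ) (ht : target a t₀ = s) (w : ℝ≥0) (hw : w ≤ U) :
    ∃ (t : ℕ → Macro Γ Λ) (u : ℕ → ℝ≥0) (J : ℕ), t 0 = t₀ ∧ u 0 = w ∧ u 1 = x ∧ u 2 = y ∧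
      (∀ j < J, (control M a).next (t j) (t (j + 1))) ∧ (control M a).exit (t J) ∧
      (∀ j ≤ J + 1, u j ≤ U) ∧
      ∀ j, 0 < j → j < J → Evolves U (op (t j)) (u j) (u (j + 2)) := by
  induction h generalizing t₀ w with
  | @halted x y hx hy =>
    refine ⟨fun j => if j = 0 then t₀ else some (none, none, none),
      fun j => if j = 0 then w else if j = 1 then x else y, 1, rfl, rfl, rfl, rfl, ?_, ?_, ?_, ?_⟩
    · intro j hj
      obtain rfl : j = 0 := by omega
      refine ⟨none, none, by simp [ht], ?_⟩
      simpa [ht] using Valid.stay (M := M)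
    · exact ⟨none, none, rfl⟩
    · intro j _
      dsimp only
      split_ifs <;> assumption
    · omega
  | @step s s' o x y z hv hx hy hb _ ih =>
    obtain ⟨t, u, J, h1, h2, h3, h4, h5, h6, h7, h8⟩ := ih (some (s, o, s')) rfl x hx
    refine ⟨fun j => j.casesOn t₀ t, fun j => j.casesOn w u, J + 1, rfl, rfl, h2, h3, ?_, h6,
      ?_, ?_⟩
    · rintro (_ | j) hj
      · exact ⟨o, s', by simp [ht, h1], ht ▸ hv⟩
      · exact h5 j (by omega)
    · rintro (_ | j) hj
      · exact hw
      · exact h7 j (by omega)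
    · rintro (_ | _ | j) hj hj'
      · omega
      · simpa [h1, h2, h4, op] using hb
      · exact h8 (j + 1) (by omega) (by omega)

/-- Registers are reliable only for macros before `J - 1`, and this suffices: macro `J` starts in
the halted phase, so macro `J - 1` either enters or keeps that phase, and both depend only on what
holds after macro `J - 2`. -/
theorem modelChecks_iff [Fintype Λ] {U V : ℕ} (hU : 0 < U) {w : List Γ}
    (hV : (V : ℝ≥0) = U * listValue w) {n : ℕ} (p : Fin n) :
    ((control M a).automaton (scale Γ Λ U V) n).ModelChecks
        (WMTL.halting p (scale Γ Λ U V).gap) ↔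
      (StateTransition.eval (TM0.step M) (TM0.init (a :: w))).Dom := by
  have hinit : (TM0.init (a :: w) : TM0.Cfg Γ Λ) =
      ⟨default, a, ListBlank.mk [], ListBlank.mk w⟩ := by
    simp [TM0.init, Tape.mk₁, Tape.mk₂, Tape.mk']
  have hval : value (ListBlank.mk ([] : List Γ)) = 0 := rfl
  have hVU : (V : ℝ≥0) ≤ U := by rw [hV]; exact mul_value_le U (ListBlank.mk w)
  rw [Control.modelChecks_iff, hinit]
  constructor
  · rintro ⟨l, d, c, N, m, H⟩
    obtain ⟨t, u, J, H⟩ := H.exists_path (fun t t' => by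
      have h1 := shift_le (op t)
      have h2 := shift_le (op t')
      have hb : 2 ≤ base Γ := by simp [base]
      -- Two fills amount to at least 18·base·U, whereas gap + unit + 1 is 10·base·U + 4·U + 4.
      have h3 : 9 * base Γ * U ≤ (10 * base Γ - shift (op t)) * U :=
        Nat.mul_le_mul_right _ (by omega)
      have h4 : 9 * base Γ * U ≤ (10 * base Γ - shift (op t')) * U :=
        Nat.mul_le_mul_right _ (by omega)
      simp only [Scale.gap, scale]
      nlinarith) (by exact_mod_cast hVU)
    -- The start macro may not exit, and macro 1 begins in the initial configuration rather than in
    -- the halted phase.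
    have hJ : 2 ≤ J := by
      obtain ⟨o, s, he⟩ := H.exit
      rcases J with _ | _ | J
      · rw [H.start] at he
        cases he
      · obtain ⟨o', s', h1, -⟩ := H.next 0 (by omega)
        rw [H.start] at h1
        rw [he] at h1
        simp [control, target] at h1
      · omega
    have key : ∀ j < J - 1, Sound M ⟨default, a, ListBlank.mk [], ListBlank.mk w⟩ U
        (target a (t j)) (u (j + 1)) (u (j + 2)) := by
      intro j hj
      induction j with
      | zero =>
        -- The start macro copies the input from register 0 to register 2, the right half tape;
        -- register 1 is 0, the empty left half.
        have := evolves_iff.1 (H.eq 0 hj)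
        rw [H.start] at this ⊢
        refine ⟨ListBlank.mk [], ListBlank.mk w, ?_, ?_, .refl⟩
        · rw [H.one, hval, mul_zero]
        · rw [value_mk, ← hV]
          simpa [control, op, Evolves, TapeOp.up, TapeOp.down, shift, H.zero, scale] using this
      | succ j ih =>
        obtain ⟨o, s, h1, h2⟩ := H.next j (by omega)
        have h3 := evolves_iff.1 (H.eq (j + 1) hj)
        rw [h1] at h3 ⊢
        exact (ih (by omega)).step hU h2 (H.le_unit (j + 3) (by omega)) h3
    obtain ⟨J, rfl⟩ := Nat.exists_eq_add_of_le' hJ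
    obtain ⟨o, s, h1, h2⟩ := H.next J (by omega)
    obtain ⟨o', s', h3, -⟩ := H.next (J + 1) (by omega)
    obtain ⟨o'', s'', h4⟩ := H.exit
    have h5 : s = none := by
      rw [h1] at h3
      rw [h3] at h4
      simp only [Option.some.injEq, Prod.mk.injEq] at h4
      exact h4.1
    subst h5
    have hs := key J (by omega)
    generalize target a (t J) = s at hs h2
    cases h2 with
    | halt hM =>
      obtain ⟨L, R, -, -, h⟩ := hs
      exact dom_of_reaches h hM
    | stay => exact hs
  · intro h
    obtain ⟨t, u, J, h1, h2, h3, h4, h5, h6, h7, h8⟩ :=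
      (leads_of_dom h U).exists_path (a := a) none rfl V hVU
    simp only [hval, mul_zero, value_mk] at h3 h4
    refine ⟨_, _, _, _, _, Control.IsPath.accepted (t := t) (u := u) (J := J)
      ⟨h1, h5, h6, h2, h3, h7, fun j hj => evolves_iff.2 ?_⟩⟩
    rcases j with _ | j
    · simp [h1, h2, h4, op, Evolves, TapeOp.up, TapeOp.down, shift, hV]
    · exact h8 (j + 1) (by omega) hj

end

end TapeControl

/-! ### A Turing machine with undecidable halting problem -/

theorem Primrec.nat_pow_const (b : ℕ) : Primrec fun k : ℕ => b ^ k := by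
  refine (Primrec.nat_rec₁ 1 (f := fun _ m => b * m) ?_).of_eq fun k => ?_
  · exact Primrec.nat_mul.comp (Primrec.const b) Primrec.snd
  · induction k with
    | zero => rfl
    | succ k ih => rw [pow_succ, mul_comm, ← ih]

namespace UniversalMachine

/-- Powers of two are used as inputs because their binary words differ only in the number of zeros.
-/
theorem replicate_append_trNat_two_pow (k : ℕ) :
    PartrecToTM2.trNat (2 ^ k) =
      List.replicate k PartrecToTM2.Γ'.bit0 ++ [PartrecToTM2.Γ'.bit1] := by
  have h : ∃ p : PosNum, ((2 ^ k : ℕ) : Num) = .pos p ∧ PartrecToTM2.trPosNum p =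
      List.replicate k PartrecToTM2.Γ'.bit0 ++ [PartrecToTM2.Γ'.bit1] := by
    induction k with
    | zero => exact ⟨.one, by simp; rfl, rfl⟩
    | succ k ih =>
      obtain ⟨p, h1, h2⟩ := ih
      refine ⟨p.bit0, ?_, by simp [PartrecToTM2.trPosNum, h2, List.replicate_succ]⟩
      rw [pow_succ, mul_two, Nat.cast_add, h1, Num.bit0_of_bit0]
      rfl
  obtain ⟨p, h1, h2⟩ := h
  rw [PartrecToTM2.trNat, h1, ← h2]
  rfl

/-- A machine that is supported by a finite set of states can be replaced by one with finitely many
states. -/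
theorem exists_finite {Γ Λ : Type} [Inhabited Γ] [Inhabited Λ] (M : TM0.Machine Γ Λ)
    {S : Finset Λ} (hS : TM0.Supports M (S : Set Λ)) :
    ∃ (Λ' : Type) (_ : Fintype Λ') (_ : Inhabited Λ') (M' : TM0.Machine Γ Λ'), ∀ l : List Γ,
      (StateTransition.eval (TM0.step M') (TM0.init l)).Dom ↔
        (StateTransition.eval (TM0.step M) (TM0.init l)).Dom := by
  classical
  let i : Inhabited {q // q ∈ S} := ⟨⟨default, hS.1⟩⟩
  let g : PointedMap Λ {q // q ∈ S} := ⟨fun q => if h : q ∈ S then ⟨q, h⟩ else default, by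
    rw [dif_pos (show default ∈ S from hS.1)]; rfl⟩
  let f : PointedMap Γ Γ := ⟨id, rfl⟩
  have hf : Function.RightInverse f f := fun _ => rfl
  have hg : ∀ q ∈ (S : Set Λ), ((g q : {q // q ∈ S}) : Λ) = q := fun q hq => by
    change ((if h : q ∈ S then ⟨q, h⟩ else default : {q // q ∈ S}) : Λ) = q
    rw [dif_pos (show q ∈ S from hq)]
  refine ⟨{q // q ∈ S}, inferInstance, i, M.map f f g Subtype.val, fun l => ?_⟩
  refine StateTransition.tr_eval_dom
    (TM0.Machine.map_respects M f f g Subtype.val hS hf hg) ⟨hS.1, ?_⟩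
  rw [TM0.map_init f g l]
  simp [f]

instance : Fintype PartrecToTM2.K' :=
  ⟨{.main, .rev, .aux, .stack}, fun x => by cases x <;> simp⟩

/-- Every partial recursive function is computed by a Turing machine with finitely many symbols and
states. -/
theorem exists_machine {f : ℕ →. ℕ} (hf : Partrec f) :
    ∃ (Γ Λ : Type) (_ : Fintype Γ) (_ : Inhabited Γ) (_ : Fintype Λ) (_ : Inhabited Λ)
      (M : TM0.Machine Γ Λ) (a b c : Γ), ∀ k,
      (StateTransition.eval (TM0.step M) (TM0.init (a :: b :: List.replicate k c))).Dom ↔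
        (f (2 ^ k)).Dom := by
  classical
  obtain ⟨code, hc⟩ := ToPartrec.Code.exists_code (Nat.Partrec'.part_iff₁.2 hf)
  let iΛ : Inhabited PartrecToTM2.Λ' := ⟨PartrecToTM2.trNormal code .halt⟩
  -- The default label is the initial state, so the instance `iΛ` makes it the entry point of
  -- `code`.
  have h2 := @TM2to1.tr_supports _ _ _ _ _ PartrecToTM2.tr iΛ _
    (PartrecToTM2.tr_supports code .halt)
  have h1 := TM1to0.tr_supports _ h2
  obtain ⟨Λ', i1, i2, M', hM⟩ := exists_finite _ h1
  -- `TM2to1.trInit` writes the list in reverse and marks the first cell as stack bottom: the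
  -- separator `cons`, then `bit1`, then the `k` copies of `bit0`.
  let s (x : PartrecToTM2.Γ') : TM2to1.Γ' PartrecToTM2.K' (fun _ => PartrecToTM2.Γ') :=
    (false, Function.update (fun _ => none) .main (some x))
  refine ⟨_, Λ', inferInstance, inferInstance, i1, i2, M', (true, (s .cons).2), s .bit1, s .bit0,
    fun k => ?_⟩
  have e : ((true, (s .cons).2) :: s .bit1 :: List.replicate k (s .bit0) : List (TM2to1.Γ' _ _)) =
      TM2to1.trInit PartrecToTM2.K'.main (PartrecToTM2.trList [2 ^ k]) := by
    simp [PartrecToTM2.trList, replicate_append_trNat_two_pow, TM2to1.trInit, s]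
    exact congrArg (fun l => _ :: _ :: l) (List.map_replicate (f := s) (a := .bit0)).symm
  have e2 : (TM2.init PartrecToTM2.K'.main (PartrecToTM2.trList [2 ^ k]) : PartrecToTM2.Cfg') =
      PartrecToTM2.init code [2 ^ k] := by
    simp only [TM2.init, PartrecToTM2.init]
    congr 1
    funext x
    cases x <;> rfl
  have t1 := congrArg Part.Dom (TM1to0.tr_eval (TM2to1.tr PartrecToTM2.tr)
    (TM2to1.trInit PartrecToTM2.K'.main (PartrecToTM2.trList [2 ^ k])))
  have t2 := TM2to1.tr_eval_dom PartrecToTM2.tr PartrecToTM2.K'.main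
    (PartrecToTM2.trList [2 ^ k])
  have t3 := congrArg Part.Dom (PartrecToTM2.tr_eval code [2 ^ k])
  have t4 := congrArg Part.Dom (hc (2 ^ k ::ᵥ List.Vector.nil))
  rw [hM, e]
  refine (Iff.of_eq t1).trans (t2.trans ?_)
  change (StateTransition.eval _ (TM2.init _ _)).Dom ↔ _
  rw [e2]
  exact (Iff.of_eq t3).trans (Iff.of_eq t4)

/-- There is a Turing machine with undecidable halting problem. -/
theorem exists_undecidable :
    ∃ (Γ Λ : Type) (_ : Fintype Γ) (_ : Inhabited Γ) (_ : Fintype Λ) (_ : Inhabited Λ)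
      (M : TM0.Machine Γ Λ) (a b c : Γ), ¬ ComputablePred fun k =>
      (StateTransition.eval (TM0.step M) (TM0.init (a :: b :: List.replicate k c))).Dom := by
  -- An unbounded search recovers `k` from `2 ^ k`, and the `k`-th code is run on 0; thus halting on
  -- the inputs `2 ^ k` encodes the halting problem.
  let f : ℕ →. ℕ := fun n =>
    (Nat.rfind fun k => Part.some (decide (2 ^ k = n))).bind fun k =>
      (Denumerable.ofNat Nat.Partrec.Code k).eval 0
  have hf : Partrec f := by
    refine Partrec.bind (Partrec.rfind ?_) ?_
    · have : Primrec₂ fun n k : ℕ => decide (2 ^ k = n) :=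
        (Primrec.eq.comp ((Primrec.nat_pow_const 2).comp Primrec.snd) Primrec.fst).decide
      exact this.to_comp
    · exact Nat.Partrec.Code.eval_part.comp
        ((Primrec.ofNat _).to_comp.comp Computable.snd) (Computable.const 0)
  obtain ⟨Γ, Λ, i1, i2, i3, i4, M, a, b, c, hM⟩ := exists_machine hf
  refine ⟨Γ, Λ, i1, i2, i3, i4, M, a, b, c, fun H => ComputablePred.halting_problem 0 ?_⟩
  refine ComputablePred.computable_of_manyOneReducible ⟨_, Computable.encode, fun c => ?_⟩ H
  have hk : Nat.rfind (fun j => Part.some (decide (2 ^ j = 2 ^ Encodable.encode c))) =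
      Part.some (Encodable.encode c) := by
    refine Part.eq_some_iff.2 (Nat.mem_rfind.2 ⟨by simp, fun {m} hm => ?_⟩)
    simp [hm.ne]
  change _ ↔ Part.Dom _
  rw [hM]
  simp only [f]
  rw [hk, Part.bind_some, Denumerable.ofNat_encode]

end UniversalMachine

/-! ### Computability of the reduction -/

theorem Primrec.list_map_const {α β : Type} [Primcodable β] {f : ℕ → α → β} (l : List α)
    (h : ∀ a ∈ l, Primrec fun k => f k a) : Primrec fun k => l.map (f k) := by
  induction l with
  | nil => exact Primrec.const []
  | cons a l ih =>
    exact Primrec.list_cons.comp (h a (by simp)) (ih fun b hb => h b (by simp [hb]))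

theorem Control.primrec_guard {T : Type} (G : Control T) {P : ℕ → Scale T}
    (hu : Primrec fun k => (P k).unit) (hi : Primrec fun k => (P k).input) (p q : G.Loc) :
    Primrec fun k => (G.guard (P k) p q).conjuncts := by
  have atom (x : Fin 2) (r : Cmp) {c : ℕ → ℕ} (hc : Primrec c) :
      Primrec fun k => (ClockConstraint.atom x r (c k)).conjuncts :=
    Primrec.list_cons.comp ((Primrec.const x).pair ((Primrec.const r).pair hc)) (Primrec.const [])
  have triv := atom 0 .ge (Primrec.const 0)
  have event (t : T) (i : ℕ) : Primrec fun k => (G.eventGuard (P k) t i).conjuncts := by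
    unfold Control.eventGuard
    split_ifs
    · exact atom _ _ (Primrec.const 0)
    · exact atom _ _ hu
    · exact atom _ _ hi
    · exact triv
    · exact triv
    · exact atom _ _ hu
  rcases p with ⟨t, i, b⟩ | b
  · rcases q with q | b'
    · cases b
      · exact event t i
      · exact atom 0 .eq hu
    · cases b <;> cases b'
      exacts [triv, atom 0 .eq hu, triv, atom 0 .eq hu]
  · cases b <;> exact triv

theorem Control.primrec_gain {T : Type} (G : Control T) {P : ℕ → Scale T}
    (hf : ∀ t, Primrec fun k => (P k).fill t) (p q : G.Loc) :
    Primrec fun k => G.gain (P k) p q := by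
  rcases p with ⟨t, i, b⟩ | b
  · rcases q with q | b'
    · cases b
      · exact Primrec.const _
      · simp only [Control.gain]
        split_ifs
        · exact hf t
        · exact Primrec.const 0
    · cases b <;> exact Primrec.const 0
  · exact Primrec.const 0

/-- The graph does not depend on `k`, so locations and transitions are fixed lists in which only the
constants of guards and costs vary. -/
theorem Control.primrec_code {T : Type} [Fintype T] (G : Control T) {P : ℕ → Scale T}
    (hu : Primrec fun k => (P k).unit) (hi : Primrec fun k => (P k).input)
    (hf : ∀ t, Primrec fun k => (P k).fill t) (a : ℕ) :
    Primrec fun k => (G.automaton (P k) a).code := by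
  have h : Primrec fun k => (G.automaton (P k) a).edges.map fun e =>
      (e.source.val, e.guard.conjuncts, e.reset, e.target.val,
        fun i => (G.automaton (P k) a).edgeCost i e) := by
    simp only [Control.automaton, List.map_map]
    refine Primrec.list_map_const _ fun p _ => ?_
    refine (Primrec.const (G.num p.1).val).pair ((G.primrec_guard hu hi p.1 p.2).pair
      ((Primrec.const (G.reset p.1 p.2)).pair ((Primrec.const (G.num p.2).val).pair
        (Primrec.fin_curry.2 ?_))))
    exact (G.primrec_gain hf (G.num.symm (G.num p.1)) (G.num.symm (G.num p.2))).comp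
      (Primrec.fst (α := ℕ) (β := Fin 1))
  have hl : Primrec fun _ : ℕ => List.ofFn fun q : Fin G.card =>
      ((ClockConstraint.atom (0 : Fin 2) .ge 0).conjuncts, (fun _ => G.rate (G.num.symm q) :
        Fin 1 → ℕ), (fun _ => G.lab (G.num.symm q) : Fin a → Bool)) := Primrec.const _
  exact (Primrec.const (G.num (G.entry G.start)).val).pair (hl.pair h)

/-! ### Computability of the code of the formula. -/

namespace WMTL

variable {a : ℕ} {φ ψ : ℕ → WMTL (Fin 1) (Fin a)}

theorem primrec_not (hφ : Primrec fun k => (φ k).code) :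
    Primrec fun k => (WMTL.not (φ k)).code :=
  Primrec.list_cons.comp (Primrec.const _) hφ

theorem primrec_or (hφ : Primrec fun k => (φ k).code) (hψ : Primrec fun k => (ψ k).code) :
    Primrec fun k => (WMTL.or (φ k) (ψ k)).code :=
  Primrec.list_cons.comp (Primrec.const _) (Primrec.list_append.comp hφ hψ)

theorem primrec_until (hφ : Primrec fun k => (φ k).code) (hψ : Primrec fun k => (ψ k).code)
    (r : Cmp) {c : ℕ → ℕ} (hc : Primrec c) :
    Primrec fun k => (WMTL.until (φ k) 0 r (c k) (ψ k)).code :=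
  Primrec.list_cons.comp
    (Primrec.sumInr.comp (Primrec.option_some.comp (Primrec.option_some.comp
      ((Primrec.const 0).pair ((Primrec.const r).pair hc)))))
    (Primrec.list_append.comp hφ hψ)

theorem primrec_halting (x : Fin a) {c : ℕ → ℕ} (hc : Primrec c) :
    Primrec fun k => (halting x (c k)).code := by
  have hlink : Primrec fun k => (link x (c k)).code :=
    primrec_or (Primrec.const _) (primrec_or (Primrec.const _)
      (primrec_until (Primrec.const _) (Primrec.const _) .eq hc))
  exact primrec_not (primrec_or (primrec_not hlink)
    (primrec_not (primrec_until hlink (Primrec.const _) .ge (Primrec.const 0))))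

end WMTL

/-! ### Computability of the encoded input. -/

namespace Digit

variable {Γ : Type} [Fintype Γ] [Inhabited Γ]

/-- The number whose expansion consists of `k` copies of a given digit. -/
noncomputable def repValue (c : Γ) : ℕ → ℕ
  | 0 => 0
  | k + 1 => repValue c k + digit c * base Γ ^ k

theorem primrec_repValue (c : Γ) : Primrec (repValue c) := by
  refine (Primrec.nat_rec₁ 0 (f := fun k m => m + digit c * base Γ ^ k) ?_).of_eq fun k => ?_
  · exact Primrec.nat_add.comp Primrec.snd (Primrec.nat_mul.comp (Primrec.const _)
      ((Primrec.nat_pow_const _).comp Primrec.fst))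
  · induction k with
    | zero => rfl
    | succ k ih => rw [repValue, ← ih]

theorem repValue_eq (c : Γ) (k : ℕ) :
    (repValue c k : ℝ≥0) = base Γ ^ k * listValue (List.replicate k c) := by
  induction k with
  | zero => simp [repValue, listValue]
  | succ k ih =>
    rw [repValue, List.replicate_succ, listValue, pow_succ, mul_assoc,
      mul_div_cancel₀ _ base_pos.ne']
    push_cast
    rw [ih]
    ring

/-- The expansion of the input has `k + 1` digits, so with block length `base ^ (k + 1)` its offset
is an integer, as clock constraints require. -/
theorem repValue_add (b c : Γ) (k : ℕ) :
    ((repValue c k + digit b * base Γ ^ k : ℕ) : ℝ≥0) =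
      (base Γ ^ (k + 1) : ℕ) * listValue (b :: List.replicate k c) := by
  push_cast
  rw [listValue, pow_succ, mul_assoc, mul_div_cancel₀ _ base_pos.ne', repValue_eq]
  ring

end Digit

theorem mainTheorem5 (a : ℕ) (ha : 0 < a) :
    ¬ ∃ f : PPTACode 2 1 a × List (WMTLToken 1 a) → Bool, Computable f ∧
      ∀ (n : ℕ) (𝒜 : PPTA (Fin n) (Fin 2) (Fin 1) (Fin a)), 𝒜.IsStopwatch 0 → 𝒜.NonBlocking →
        ∀ φ : WMTL (Fin 1) (Fin a), f (𝒜.code, φ.code) = true ↔ 𝒜.ModelChecks φ := by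
  rintro ⟨f, hf, h⟩
  obtain ⟨Γ, Λ, _, _, _, _, M, b₀, b₁, b₂, hM⟩ := UniversalMachine.exists_undecidable
  let U (k : ℕ) : ℕ := base Γ ^ (k + 1)
  let V (k : ℕ) : ℕ := repValue b₂ k + digit b₁ * base Γ ^ k
  let P (k : ℕ) := TapeControl.scale Γ Λ (U k) (V k)
  let G := TapeControl.control M b₀
  have hU : Primrec U := (Primrec.nat_pow_const _).comp Primrec.succ
  have hV : Primrec V := Primrec.nat_add.comp (primrec_repValue b₂)
    (Primrec.nat_mul.comp (Primrec.const _) (Primrec.nat_pow_const _))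
  have hfill (t) : Primrec fun k => (P k).fill t :=
    Primrec.nat_mul.comp (Primrec.const _) hU
  have hgap : Primrec fun k => (P k).gap :=
    Primrec.nat_add.comp (Primrec.nat_add.comp (Primrec.nat_mul.comp (Primrec.const _) hU)
      (Primrec.nat_mul.comp (Primrec.const 3) hU)) (Primrec.const 3)
  refine hM (ComputablePred.computable_iff.2 ⟨fun k => f ((G.automaton (P k) a).code,
    (WMTL.halting ⟨0, ha⟩ (P k).gap).code), ?_, funext fun k => propext ?_⟩)
  · exact hf.comp ((G.primrec_code (P := P) hU hV hfill a).pair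
      (WMTL.primrec_halting ⟨0, ha⟩ hgap)).to_comp
  · rw [h _ _ (G.isStopwatch (P k) a) (G.nonBlocking (P k) a)]
    exact (TapeControl.modelChecks_iff (pow_pos (by simp [base]) _) (repValue_add b₁ b₂ k) _).symm
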